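/- **Setting.** Let $(L,g_L)$ be a smooth Riemannian manifold and let $(K,\varphi,g_K)$ be a Kähler manifold, i.e. $\varphi$ is a smooth almost complex structure ($\varphi^2=-I$) with $g_K(\varphi X,\varphi Y)=g_K(X,Y)$ and $\nabla^K\varphi=0$, where $\nabla^L,\nabla^K$ denote the Levi-Civita connections. Let $G:L\to K$ be a conformal pointwise slant Riemannian map (CPSRM). This means that $G$ is smooth; that there is a smooth function $\lambda>0$ on $L$ with $g_K(G_*X,G_*Y)=\lambda^2 g_L(X,Y)$ for all $X,Y\in(\ker G_*)^\perp$; and that for each $p\in L$ the Wirtinger angle between $\varphi v$ and $\operatorname{range}G_{*p}$ is the same number $\Theta(p)$ for all nonzero $v\in\operatorname{range}G_{*p}$. For $v\in\operatorname{range}G_*$ write $\varphi v=\rho v+\varpi v$, and for $P\in(\operatorname{range}G_*)^\perp$ write $\varphi P=\mathcal DP+\mathcal EP$, with $\rho v,\mathcal DP\in\operatorname{range}G_*$ and $\varpi v,\mathcal EP\in(\operatorname{range}G_*)^\perp$. Let ${}^*G_*$ be the adjoint of $G_*$ with respect to $g_L,g_K$, let $\nabla^G$ be the pullback of $\nabla^K$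 to vector fields along $G$, and let $\nabla^{G\perp}_XV$ be the $(\operatorname{range}G_*)^\perp$-component of $\nabla^G_XV$. Let $(\nabla G_*)(X,Y)=\nabla^G_X G_*Y-G_*(\nabla^L_XY)$ be the second fundamental form, and $(\nabla G_*)^\perp(X,Y)$ its $(\operatorname{range}G_*)^\perp$-component. Let $\Gamma((\ker G_*)^\perp)$ be the smooth horizontal vector fields on $L$ and $\Gamma((\operatorname{range}G_*)^\perp)$ the smooth vector fields along $G$ normal to $\operatorname{range}G_*$. **Theorem 4.1.** Any two of the following assertions imply the third. (i) $\operatorname{range}G_*$ is integrable: if smooth vector fields $A,B$ on an open set $V\subseteq K$ satisfy $A(G(p)),B(G(p))\in\operatorname{range}G_{*p}$ for all $p$ in an open set $U\subseteq L$ with $G(U)\subseteq V$, then $[A,B](G(p))\in\operatorname{range}G_{*p}$ for all $p\in U$. (ii) For all $Y,Z\in\Gamma((\ker G_*)^\perp)$ and $P\in\Gamma((\operatorname{range}G_*)^\perp)$, $$g_K\big(\nabla^{G\perp}_Z\varpi\rho G_*Y-\nabla^{G\perp}_Y\varpi\rho G_*Z,\;P\big)=g_K\big(\nabla^{G\perp}_Z\varpi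 G_*Y-\nabla^{G\perp}_Y\varpi G_*Z,\;\mathcal EP\big).$$ (iii) For all $Y,Z\in\Gamma((\ker G_*)^\perp)$ and $P\in\Gamma((\operatorname{range}G_*)^\perp)$, $$g_K\big((\nabla G_*)^\perp(Y,{}^*G_*\mathcal DP),\;\varpi G_*Z\big)=g_K\big((\nabla G_*)^\perp(Z,{}^*G_*\mathcal DP),\;\varpi G_*Y\big).$$ -/

import Mathlib

open Bundle Set
open scoped Manifold ContDiff Topology InnerProductSpace

noncomputable section

namespace SlantMaps

/-! ### The Levi-Civita connection of a Riemannian manifold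

Manifolds are modelled on a finite-dimensional real vector space `E` (no boundary). A Riemannian
metric is an instance of `RiemannianBundle` on the tangent bundle, smooth in the sense of
`IsContMDiffRiemannianBundle`. -/

section LeviCivita

variable {E : Type*} [NormedAddCommGroup E] [NormedSpace ℝ E]
  {M : Type*} [TopologicalSpace M] [ChartedSpace E M]

instance tangentSpace_finiteDimensional [FiniteDimensional ℝ E] (x : M) :
    FiniteDimensional ℝ (TangentSpace 𝓘(ℝ, E) x) :=
  inferInstanceAs (FiniteDimensional ℝ E)

variable [IsManifold 𝓘(ℝ, E) ∞ M]

/-- The coordinates of a tangent vector at `y` with respect to the coordinate frame of the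
preferred chart at `x` (meaningful for `y` in the domain of that chart). -/
def coords (x y : M) : TangentSpace 𝓘(ℝ, E) y →L[ℝ] E :=
  (trivializationAt E (TangentSpace 𝓘(ℝ, E)) x).continuousLinearMapAt ℝ y

/-- The tangent vector at `x` with given coordinates in the preferred chart at `x`. -/
def ofCoords (x : M) : E →L[ℝ] TangentSpace 𝓘(ℝ, E) x :=
  (trivializationAt E (TangentSpace 𝓘(ℝ, E)) x).symmL ℝ x

theorem mdifferentiableAt_coords {σ : Π x : M, TangentSpace 𝓘(ℝ, E) x} {x : M}
    (hσ : MDiffAt (T% σ) x) :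
    MDifferentiableAt 𝓘(ℝ, E) 𝓘(ℝ, E) (fun y => coords x y (σ y)) x := by
  refine ((mdifferentiableAt_section 𝓘(ℝ, E) σ).1 hσ).congr_of_eventuallyEq ?_
  filter_upwards [(trivializationAt E (TangentSpace 𝓘(ℝ, E)) x).open_baseSet.mem_nhds
    (FiberBundle.mem_baseSet_trivializationAt' x)] with y hy
  exact Bundle.Trivialization.continuousLinearMapAt_apply_of_mem ℝ _ hy (σ y)

theorem ofCoords_coords (x : M) (v : TangentSpace 𝓘(ℝ, E) x) : ofCoords x (coords x x v) = v :=
  Bundle.Trivialization.symmL_continuousLinearMapAt _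
    (FiberBundle.mem_baseSet_trivializationAt' x) v

variable [RiemannianBundle (fun x : M => TangentSpace 𝓘(ℝ, E) x)]

/-- The Koszul expression `(u g(v, w) + v g(u, w) - w g(u, v)) / 2` at `x`, where `u, v, w` are
extended near `x` by the vector fields with constant coordinates in the preferred chart at `x`
(this is what `FiberBundle.extend` does); these fields commute. -/
def koszul (x : M) (u v w : TangentSpace 𝓘(ℝ, E) x) : ℝ :=
  (mvfderiv 𝓘(ℝ, E) (fun y : M => ⟪FiberBundle.extend E v y, FiberBundle.extend E w y⟫_ℝ) x u
    + mvfderiv 𝓘(ℝ, E) (fun y : M => ⟪FiberBundle.extend E u y, FiberBundle.extend E w y⟫_ℝ) x v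
    - mvfderiv 𝓘(ℝ, E) (fun y : M => ⟪FiberBundle.extend E u y, FiberBundle.extend E v y⟫_ℝ) x w)
    / 2

variable [FiniteDimensional ℝ E]

/-- The Christoffel map at `x` in the preferred chart at `x`: `christoffel x v u` is the vector
`Γ(u, v)` determined by `⟪Γ(u, v), w⟫ = koszul x u v w`. -/
def christoffel (x : M) (v : TangentSpace 𝓘(ℝ, E) x) :
    TangentSpace 𝓘(ℝ, E) x →L[ℝ] TangentSpace 𝓘(ℝ, E) x :=
  let b := stdOrthonormalBasis ℝ (TangentSpace 𝓘(ℝ, E) x)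
  ∑ i, ∑ j, ∑ k, (⟪b j, v⟫_ℝ * koszul x (b i) (b j) (b k)) • (innerSL ℝ (b i)).smulRight (b k)

/-- The Levi-Civita connection of a Riemannian manifold: `∇_X σ = D_X σ + Γ(X, σ)`, computed at
each point `x` in the preferred chart at `x`. As in Mathlib, `leviCivita M σ x u` is the value
`(∇_u σ)(x)`. -/
def leviCivita (M : Type*) [TopologicalSpace M] [ChartedSpace E M] [IsManifold 𝓘(ℝ, E) ∞ M]
    [RiemannianBundle (fun x : M => TangentSpace 𝓘(ℝ, E) x)] :
    CovariantDerivative 𝓘(ℝ, E) E (TangentSpace 𝓘(ℝ, E) : M → Type _) where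
  toFun σ x := ofCoords x ∘L mvfderiv 𝓘(ℝ, E) (fun y => coords x y (σ y)) x + christoffel x (σ x)
  isCovariantDerivativeOnUniv := by
    have hc : ∀ (x : M) (v w : TangentSpace 𝓘(ℝ, E) x),
        christoffel x (v + w) = christoffel x v + christoffel x w := by
      intro x v w
      simp only [christoffel, inner_add_right, add_mul, add_smul, Finset.sum_add_distrib]
    have hs : ∀ (x : M) (c : ℝ) (v : TangentSpace 𝓘(ℝ, E) x),
        christoffel x (c • v) = c • christoffel x v := by
      intro x c v
      simp only [christoffel, inner_smul_right, mul_assoc, mul_smul, Finset.smul_sum]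
    constructor
    · intro σ σ' x hσ hσ' _
      have h : (fun y => coords x y ((σ + σ') y))
          = (fun y => coords x y (σ y)) + fun y => coords x y (σ' y) := by
        ext y; simp
      rw [h, mvfderiv_add (mdifferentiableAt_coords hσ) (mdifferentiableAt_coords hσ')]
      simp only [Pi.add_apply, hc, ContinuousLinearMap.comp_add]
      abel
    · intro σ g x hσ hg _
      have h : (fun y => coords x y ((g • σ) y)) = g • fun y => coords x y (σ y) := by
        ext y; simp
      rw [h, mvfderiv_smul hg (mdifferentiableAt_coords hσ)]
      simp only [Pi.smul_apply', hs]
      ext w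
      simp [ofCoords_coords]
      abel

/-- `(M, g, J)` is a Kähler manifold: `J` is a smooth almost complex structure (`J² = -1`), the
metric is Hermitian, and `J` is parallel, `(∇_X J) Y = ∇_X (J Y) - J (∇_X Y) = 0`. -/
structure IsKahler (J : Π x : M, TangentSpace 𝓘(ℝ, E) x →L[ℝ] TangentSpace 𝓘(ℝ, E) x) :
    Prop where
  smooth : ContMDiff 𝓘(ℝ, E) (𝓘(ℝ, E).prod 𝓘(ℝ, E →L[ℝ] E)) ∞
    (fun x => TotalSpace.mk' (E →L[ℝ] E)
      (E := fun x : M => TangentSpace 𝓘(ℝ, E) x →L[ℝ] TangentSpace 𝓘(ℝ, E) x) x (J x))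
  sq_eq_neg : ∀ (x : M) (v : TangentSpace 𝓘(ℝ, E) x), J x (J x v) = -v
  hermitian : ∀ (x : M) (v w : TangentSpace 𝓘(ℝ, E) x), ⟪J x v, J x w⟫_ℝ = ⟪v, w⟫_ℝ
  parallel : ∀ (Y : Π x : M, TangentSpace 𝓘(ℝ, E) x) (x : M), MDiffAt (T% Y) x →
    ∀ u : TangentSpace 𝓘(ℝ, E) x,
      leviCivita M (fun y => J y (Y y)) x u = J x (leviCivita M Y x u)

end LeviCivita

/-! ### Geometry of a map between Riemannian manifolds -/

section Maps

variable (E : Type*) [NormedAddCommGroup E] [NormedSpace ℝ E] [FiniteDimensional ℝ E]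
  {L : Type*} [TopologicalSpace L] [ChartedSpace E L] [IsManifold 𝓘(ℝ, E) ∞ L]
  [RiemannianBundle (fun x : L => TangentSpace 𝓘(ℝ, E) x)]
  (F : Type*) [NormedAddCommGroup F] [NormedSpace ℝ F] [FiniteDimensional ℝ F]
  {K : Type*} [TopologicalSpace K] [ChartedSpace F K] [IsManifold 𝓘(ℝ, F) ∞ K]
  [RiemannianBundle (fun x : K => TangentSpace 𝓘(ℝ, F) x)]

/-- The differential `G_*` of `G` at `p`. -/
def push (G : L → K) (p : L) : TangentSpace 𝓘(ℝ, E) p →L[ℝ] TangentSpace 𝓘(ℝ, F) (G p) :=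
  mfderiv 𝓘(ℝ, E) 𝓘(ℝ, F) G p

/-- The horizontal space `(ker G_*)^⊥` at `p`. -/
def horizontal (G : L → K) (p : L) : Submodule ℝ (TangentSpace 𝓘(ℝ, E) p) :=
  (LinearMap.ker (push E F G p).toLinearMap)ᗮ

/-- The space `range G_*` at `p`, a subspace of the tangent space of `K` at `G p`. -/
def rangeAt (G : L → K) (p : L) : Submodule ℝ (TangentSpace 𝓘(ℝ, F) (G p)) :=
  LinearMap.range (push E F G p).toLinearMap

/-- The adjoint `*G_*` of `G_*` at `p` with respect to the two metrics. -/
def pushAdjoint (G : L → K) (p : L) (v : TangentSpace 𝓘(ℝ, F) (G p)) : TangentSpace 𝓘(ℝ, E) p :=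
  LinearMap.adjoint (push E F G p).toLinearMap v

/-- Smoothness of a vector field `V` along `G`, that is, of a section of the pullback bundle
`G⁻¹TK`. -/
def SmoothAlong (G : L → K) (V : Π p : L, TangentSpace 𝓘(ℝ, F) (G p)) : Prop :=
  ContMDiff 𝓘(ℝ, E) 𝓘(ℝ, F).tangent ∞ (fun p => (⟨G p, V p⟩ : TangentBundle 𝓘(ℝ, F) K))

/-- The pullback connection `∇^G` of the Levi-Civita connection of `K` on vector fields along `G`.
If `V = ∑ vⁱ (eᵢ ∘ G)` with `eᵢ` the coordinate frame of the preferred chart at `G p`, then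
`∇^G_X V = ∑ X(vⁱ) eᵢ + vⁱ ∇_{G_* X} eᵢ` at `p`. -/
def pullbackConnection (G : L → K) (V : Π p : L, TangentSpace 𝓘(ℝ, F) (G p)) (p : L) :
    TangentSpace 𝓘(ℝ, E) p →L[ℝ] TangentSpace 𝓘(ℝ, F) (G p) :=
  ofCoords (G p) ∘L mvfderiv 𝓘(ℝ, E) (fun q => coords (G p) (G q) (V q)) p
    + leviCivita (E := F) K (FiberBundle.extend F (V p)) (G p) ∘L push E F G p

/-- The second fundamental form
`(∇G_*)(X, Y) = ∇^G_X (G_* Y) - G_* (∇_X Y)` of `G`, on vector fields of `L`. -/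
def secondFundamentalForm (G : L → K) (X Y : Π p : L, TangentSpace 𝓘(ℝ, E) p) (p : L) :
    TangentSpace 𝓘(ℝ, F) (G p) :=
  pullbackConnection E F G (fun q => push E F G q (Y q)) p (X p) - push E F G p (leviCivita L Y p (X p))

/-- The component `(∇G_*)^⊥(X, Y)` of the second fundamental form in `(range G_*)^⊥`. -/
def secondFundamentalFormPerp (G : L → K) (X Y : Π p : L, TangentSpace 𝓘(ℝ, E) p) (p : L) :
    TangentSpace 𝓘(ℝ, F) (G p) :=
  (rangeAt E F G p)ᗮ.starProjection (secondFundamentalForm E F G X Y p)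

/-- The normal connection `∇^{G⊥}_X V`: the component of `∇^G_X V` in `(range G_*)^⊥`. -/
def normalConnection (G : L → K) (X : Π p : L, TangentSpace 𝓘(ℝ, E) p)
    (V : Π p : L, TangentSpace 𝓘(ℝ, F) (G p)) (p : L) : TangentSpace 𝓘(ℝ, F) (G p) :=
  (rangeAt E F G p)ᗮ.starProjection (pullbackConnection E F G V p (X p))

/-- The component of `J v` in `range G_*`: `ρ v` for `v` in `range G_*`, and `𝒟 v` for `v` in
`(range G_*)^⊥`. -/
def tangentPart (G : L → K)
    (J : Π x : K, TangentSpace 𝓘(ℝ, F) x →L[ℝ] TangentSpace 𝓘(ℝ, F) x) (p : L)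
    (v : TangentSpace 𝓘(ℝ, F) (G p)) : TangentSpace 𝓘(ℝ, F) (G p) :=
  (rangeAt E F G p).starProjection (J (G p) v)

/-- The component of `J v` in `(range G_*)^⊥`: `ϖ v` for `v` in `range G_*`, and `ℰ v` for `v` in
`(range G_*)^⊥`. -/
def normalPart (G : L → K)
    (J : Π x : K, TangentSpace 𝓘(ℝ, F) x →L[ℝ] TangentSpace 𝓘(ℝ, F) x) (p : L)
    (v : TangentSpace 𝓘(ℝ, F) (G p)) : TangentSpace 𝓘(ℝ, F) (G p) :=
  (rangeAt E F G p)ᗮ.starProjection (J (G p) v)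

/-- `G` is a conformal Riemannian map: it is smooth, and there is a smooth positive function `l`
(the dilation) with `g_K(G_* X, G_* Y) = l² g_L(X, Y)` for horizontal `X, Y`. -/
def IsConformalRiemannianMap (G : L → K) : Prop :=
  ContMDiff 𝓘(ℝ, E) 𝓘(ℝ, F) ∞ G ∧
  ∃ l : L → ℝ, ContMDiff 𝓘(ℝ, E) 𝓘(ℝ) ∞ l ∧ (∀ p, 0 < l p) ∧
    ∀ p, ∀ X ∈ horizontal E F G p, ∀ Y ∈ horizontal E F G p,
      ⟪push E F G p X, push E F G p Y⟫_ℝ = l p ^ 2 * ⟪X, Y⟫_ℝ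

/-- The Wirtinger angle between `J v` and the space `range G_*` at `p`: the angle between `J v` and
its orthogonal projection to that space (`π / 2` if the projection vanishes). -/
def wirtingerAngle (G : L → K)
    (J : Π x : K, TangentSpace 𝓘(ℝ, F) x →L[ℝ] TangentSpace 𝓘(ℝ, F) x) (p : L)
    (v : TangentSpace 𝓘(ℝ, F) (G p)) : ℝ :=
  InnerProductGeometry.angle (J (G p) v) (tangentPart E F G J p v)

/-- `G` is a conformal pointwise slant Riemannian map: a conformal Riemannian map such that, at
each point, the Wirtinger angle of a nonzero vector `v = G_* Z` does not depend on `v`. -/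
def IsCPSRM (G : L → K)
    (J : Π x : K, TangentSpace 𝓘(ℝ, F) x →L[ℝ] TangentSpace 𝓘(ℝ, F) x) : Prop :=
  IsConformalRiemannianMap E F G ∧
  ∃ Θ : L → ℝ, ∀ p, ∀ v ∈ rangeAt E F G p, v ≠ 0 → wirtingerAngle E F G J p v = Θ p

/-- `Γ((ker G_*)^⊥)`: smooth horizontal vector fields on `L`. -/
def IsHorizontalField (G : L → K) (Y : Π p : L, TangentSpace 𝓘(ℝ, E) p) : Prop :=
  ContMDiff 𝓘(ℝ, E) 𝓘(ℝ, E).tangent ∞ (fun p => (⟨p, Y p⟩ : TangentBundle 𝓘(ℝ, E) L)) ∧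
  ∀ p, Y p ∈ horizontal E F G p

/-- `Γ((range G_*)^⊥)`: smooth vector fields along `G` that are normal to `range G_*`. -/
def IsNormalField (G : L → K) (P : Π p : L, TangentSpace 𝓘(ℝ, F) (G p)) : Prop :=
  SmoothAlong E F G P ∧ ∀ p, P p ∈ (rangeAt E F G p)ᗮ

/-- Integrability (involutivity) of `range G_*`: whenever two smooth vector fields `A, B` on an
open subset `V` of `K` are tangent to `range G_*` along the restriction of `G` to an open set `U`
of `L` with `G(U) ⊆ V`, so is their Lie bracket. -/
def RangeIntegrable (G : L → K) : Prop :=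
  ∀ (U : Set L) (V : Set K), IsOpen U → IsOpen V → MapsTo G U V →
  ∀ A B : Π x : K, TangentSpace 𝓘(ℝ, F) x,
    ContMDiffOn 𝓘(ℝ, F) 𝓘(ℝ, F).tangent ∞ (fun x => (⟨x, A x⟩ : TangentBundle 𝓘(ℝ, F) K)) V →
    ContMDiffOn 𝓘(ℝ, F) 𝓘(ℝ, F).tangent ∞ (fun x => (⟨x, B x⟩ : TangentBundle 𝓘(ℝ, F) K)) V →
    (∀ p ∈ U, A (G p) ∈ rangeAt E F G p) → (∀ p ∈ U, B (G p) ∈ rangeAt E F G p) →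
    ∀ p ∈ U, VectorField.mlieBracket 𝓘(ℝ, F) A B (G p) ∈ rangeAt E F G p

/-- The identity
`g_K(∇^{G⊥}_Z ϖρG_*Y - ∇^{G⊥}_Y ϖρG_*Z, P) = g_K(∇^{G⊥}_Z ϖG_*Y - ∇^{G⊥}_Y ϖG_*Z, ℰP)`
for all horizontal fields `Y, Z` and all normal fields `P`. -/
def NormalConnectionIdentity (G : L → K)
    (J : Π x : K, TangentSpace 𝓘(ℝ, F) x →L[ℝ] TangentSpace 𝓘(ℝ, F) x) : Prop :=
  ∀ (Y Z : Π p : L, TangentSpace 𝓘(ℝ, E) p) (P : Π p : L, TangentSpace 𝓘(ℝ, F) (G p)),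
    IsHorizontalField E F G Y → IsHorizontalField E F G Z → IsNormalField E F G P → ∀ p : L,
    ⟪normalConnection E F G Z (fun q => normalPart E F G J q (tangentPart E F G J q (push E F G q (Y q)))) p
        - normalConnection E F G Y (fun q => normalPart E F G J q (tangentPart E F G J q (push E F G q (Z q)))) p,
      P p⟫_ℝ
    = ⟪normalConnection E F G Z (fun q => normalPart E F G J q (push E F G q (Y q))) p
        - normalConnection E F G Y (fun q => normalPart E F G J q (push E F G q (Z q))) p,
      normalPart E F G J p (P p)⟫_ℝ

/-- The identity `g_K((∇G_*)^⊥(Y, *G_*𝒟P), ϖG_*Z) = g_K((∇G_*)^⊥(Z, *G_*𝒟P), ϖG_*Y)`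
for all horizontal fields `Y, Z` and all normal fields `P`. -/
def NormalSecondFundamentalFormSymmetric (G : L → K)
    (J : Π x : K, TangentSpace 𝓘(ℝ, F) x →L[ℝ] TangentSpace 𝓘(ℝ, F) x) : Prop :=
  ∀ (Y Z : Π p : L, TangentSpace 𝓘(ℝ, E) p) (P : Π p : L, TangentSpace 𝓘(ℝ, F) (G p)),
    IsHorizontalField E F G Y → IsHorizontalField E F G Z → IsNormalField E F G P → ∀ p : L,
    ⟪secondFundamentalFormPerp E F G Y (fun q => pushAdjoint E F G q (tangentPart E F G J q (P q))) p,
      normalPart E F G J p (push E F G p (Z p))⟫_ℝ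
    = ⟪secondFundamentalFormPerp E F G Z (fun q => pushAdjoint E F G q (tangentPart E F G J q (P q))) p,
      normalPart E F G J p (push E F G p (Y p))⟫_ℝ

end Maps

end SlantMaps

end

noncomputable section

namespace SlantMaps

/-! ### Differentiation of vector-valued functions in the preferred chart. -/

section Calculus

variable {E : Type*} [NormedAddCommGroup E] [NormedSpace ℝ E]
  {M : Type*} [TopologicalSpace M] [ChartedSpace E M]
  {H₁ : Type*} [NormedAddCommGroup H₁] [NormedSpace ℝ H₁]
  {H₂ : Type*} [NormedAddCommGroup H₂] [NormedSpace ℝ H₂]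
  {H₃ : Type*} [NormedAddCommGroup H₃] [NormedSpace ℝ H₃]

/-! The three assertions are not on an equal footing: (i) holds for every conformal Riemannian map,
and (ii) and (iii) are equivalent for every CPSRM. Both facts rest on the symmetry of the normal
part of `∇^G_Y G_*Z` in `Y, Z` (`pullbackConnection_push_sub_mem_rangeAt`): the Hessian of `G` in
charts is symmetric and the connection of `K` is torsion-free.

For (i), conformality gives `G_* *G_* = l² π`, with `π` the orthogonal projection to `range G_*`.
Hence `l⁻² *G_*` lifts fields tangent to the range to differentiable fields on `L`. If `A`, `B` lift
to `W_A`, `W_B`, then `[A, B] ∘ G = ∇^G_{W_A} G_*W_B - ∇^G_{W_B} G_*W_A`, which lies in the range by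
the symmetry. The same formula makes `π`, hence `ρ, ϖ, 𝒟, ℰ`, preserve differentiability.

For (ii) ⟺ (iii), let `c = cos² Θ(p)`, so that `ρ² = -c` on the range at `p`. Expanding `g(∇^G_Y
G_*Z, P) = g(J ∇^G_Y G_*Z, J P)` with `J` parallel and `J = ρ + ϖ` or `𝒟 + ℰ` gives
`inner_pullbackConnection_push`: `(1 - c) g(∇^G_Y G_*Z, P) = -g(∇^{G⊥}_Y ϖρG_*Z, P) + g(∇^{G⊥}_Y
ϖG_*Z, ℰP) - l⁻² g((∇G_*)^⊥(Y, *G_*𝒟P), ϖG_*Z)`. Antisymmetrising in `Y, Z` kills the left side;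
what remains says that the defect in (ii) is, up to the factor `l²`, the defect in (iii). No
regularity of `Θ` enters, since `c` is needed only at the one point `p`. -/

theorem differentiableAt_comp_extChartAt_symm {f : M → H₁} {p : M}
    (hf : MDifferentiableAt 𝓘(ℝ, E) 𝓘(ℝ, H₁) f p) :
    DifferentiableAt ℝ (f ∘ (extChartAt 𝓘(ℝ, E) p).symm) (extChartAt 𝓘(ℝ, E) p p) := by
  have h := hf.mdifferentiableWithinAt (s := univ)
    |>.differentiableWithinAt_comp_extChartAt_symm
  simpa only [preimage_univ, univ_inter, modelWithCornersSelf_coe, range_id,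
    differentiableWithinAt_univ] using h

theorem mvfderiv_apply {f : M → H₁} {p : M}
    (hf : MDifferentiableAt 𝓘(ℝ, E) 𝓘(ℝ, H₁) f p) (u : TangentSpace 𝓘(ℝ, E) p) :
    mvfderiv 𝓘(ℝ, E) f p u
      = fderiv ℝ (f ∘ (extChartAt 𝓘(ℝ, E) p).symm) (extChartAt 𝓘(ℝ, E) p p) u := by
  have h : mvfderiv 𝓘(ℝ, E) f p u = mfderiv 𝓘(ℝ, E) 𝓘(ℝ, H₁) f p u := rfl
  rw [h, hf.mfderiv]
  simp [writtenInExtChartAt, fderivWithin_univ]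
  rfl

theorem mvfderiv_congr {f g : M → H₁} {p : M} (h : f =ᶠ[𝓝 p] g) :
    mvfderiv 𝓘(ℝ, E) f p = mvfderiv 𝓘(ℝ, E) g p := by
  have h1 := h.mfderiv_eq (I := 𝓘(ℝ, E)) (I' := 𝓘(ℝ, H₁))
  ext u
  exact congrArg (fun A : E →L[ℝ] H₁ => A u) h1

/-- The Leibniz rule behind all local formulas below: the metric, `J` and `G_*` are each read as an
operator-valued function applied to coordinate vectors. -/
theorem mvfderiv_clm_apply {A : M → H₁ →L[ℝ] H₂} {f : M → H₁} {p : M}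
    (hA : MDifferentiableAt 𝓘(ℝ, E) 𝓘(ℝ, H₁ →L[ℝ] H₂) A p)
    (hf : MDifferentiableAt 𝓘(ℝ, E) 𝓘(ℝ, H₁) f p) (u : TangentSpace 𝓘(ℝ, E) p) :
    mvfderiv 𝓘(ℝ, E) (fun q => A q (f q)) p u
      = mvfderiv 𝓘(ℝ, E) A p u (f p) + A p (mvfderiv 𝓘(ℝ, E) f p u) := by
  have h := (differentiableAt_comp_extChartAt_symm hA).hasFDerivAt.clm_apply
    (differentiableAt_comp_extChartAt_symm hf).hasFDerivAt
  rw [mvfderiv_apply (hA.clm_apply hf), mvfderiv_apply hA, mvfderiv_apply hf]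
  refine (congrArg (fun B : E →L[ℝ] H₂ => B u) h.fderiv).trans ?_
  rw [add_comm]
  simp only [Function.comp, extChartAt_to_inv]
  rfl

theorem mdifferentiableAt_clm_of_apply [FiniteDimensional ℝ H₁] {A : M → H₁ →L[ℝ] H₂} {p : M}
    (hA : ∀ a, MDifferentiableAt 𝓘(ℝ, E) 𝓘(ℝ, H₂) (fun q => A q a) p) :
    MDifferentiableAt 𝓘(ℝ, E) 𝓘(ℝ, H₁ →L[ℝ] H₂) A p := by
  let b := Module.finBasis ℝ H₁
  have h : A = fun q => ∑ i, ContinuousLinearMap.smulRightL ℝ H₁ H₂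
      (LinearMap.toContinuousLinearMap (b.coord i)) (A q (b i)) := by
    funext q
    ext v
    conv_lhs => rw [← b.sum_repr v]
    simp [-Module.Basis.sum_repr]
  rw [h]
  have h1 : ∀ i, MDifferentiableAt 𝓘(ℝ, E) 𝓘(ℝ, H₁ →L[ℝ] H₂) (fun q =>
      ContinuousLinearMap.smulRightL ℝ H₁ H₂
      (LinearMap.toContinuousLinearMap (b.coord i)) (A q (b i))) p := fun i =>
    (ContinuousLinearMap.differentiableAt _).comp_mdifferentiableAt (hA (b i))
  have h2 : ∀ s : Finset (Fin (Module.finrank ℝ H₁)),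
      MDifferentiableAt 𝓘(ℝ, E) 𝓘(ℝ, H₁ →L[ℝ] H₂) (fun q =>
        ∑ i ∈ s, ContinuousLinearMap.smulRightL ℝ H₁ H₂
        (LinearMap.toContinuousLinearMap (b.coord i)) (A q (b i))) p := by
    intro s
    classical
    induction s using Finset.induction_on with
    | empty => simpa using mdifferentiableAt_const
    | insert i s hi ih =>
      simp only [Finset.sum_insert hi]
      exact (h1 i).add ih
  exact h2 _

end Calculus

/-! ### Coordinate frames of the tangent bundle. -/

section Coordinates

variable {E : Type*} [NormedAddCommGroup E] {M : Type*} [TopologicalSpace M] [ChartedSpace E M]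

variable (E) in
/-- The domain of the preferred chart at `x`. -/
def chartDomain (x : M) : Set M :=
  (chartAt E x).source

theorem chartDomain_mem_nhds (x : M) : chartDomain E x ∈ 𝓝 x :=
  (chartAt E x).open_source.mem_nhds (mem_chart_source E x)

theorem mem_chartDomain (x : M) : x ∈ chartDomain E x := mem_chart_source E x

variable [NormedSpace ℝ E] [IsManifold 𝓘(ℝ, E) ∞ M]

theorem mem_baseSet_of_mem_chartDomain {x y : M} (hy : y ∈ chartDomain E x) :
    y ∈ (trivializationAt E (TangentSpace 𝓘(ℝ, E)) x).baseSet := hy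

/-- The tangent vector at `y` with given coordinates with respect to the coordinate frame of the
preferred chart at `x`. -/
def frame (x y : M) : E →L[ℝ] TangentSpace 𝓘(ℝ, E) y :=
  (trivializationAt E (TangentSpace 𝓘(ℝ, E)) x).symmL ℝ y

theorem frame_self (x : M) : frame x x = ofCoords (E := E) x := rfl

theorem frame_coords {x y : M} (hy : y ∈ chartDomain E x) (v : TangentSpace 𝓘(ℝ, E) y) :
    frame x y (coords x y v) = v :=
  Bundle.Trivialization.symmL_continuousLinearMapAt _ (mem_baseSet_of_mem_chartDomain hy) v

theorem coords_frame {x y : M} (hy : y ∈ chartDomain E x) (a : E) :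
    coords x y (frame x y a) = a :=
  Bundle.Trivialization.continuousLinearMapAt_symmL _ (mem_baseSet_of_mem_chartDomain hy) a

theorem extend_eq_frame {x : M} (v : TangentSpace 𝓘(ℝ, E) x) {y : M} (hy : y ∈ chartDomain E x) :
    FiberBundle.extend E v y = frame x y (coords x x v) := by
  have h1 := Bundle.Trivialization.continuousLinearMapAt_apply_of_mem
    (e := trivializationAt E (TangentSpace 𝓘(ℝ, E)) x) ℝ
    (FiberBundle.mem_baseSet_trivializationAt' x) v
  rw [coords, h1, frame, Bundle.Trivialization.symmL_apply _ (mem_baseSet_of_mem_chartDomain hy)]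
  rfl

theorem coords_apply {x y : M} (hy : y ∈ chartDomain E x) (v : TangentSpace 𝓘(ℝ, E) y) :
    coords x y v = (trivializationAt E (TangentSpace 𝓘(ℝ, E)) x ⟨y, v⟩).2 :=
  Bundle.Trivialization.continuousLinearMapAt_apply_of_mem ℝ _ (mem_baseSet_of_mem_chartDomain hy) v

theorem coords_eq_mfderiv {x y : M} (hy : y ∈ chartDomain E x) :
    coords x y = mfderiv 𝓘(ℝ, E) 𝓘(ℝ, E) (extChartAt 𝓘(ℝ, E) x) y :=
  TangentBundle.continuousLinearMapAt_trivializationAt hy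

theorem coords_self (x : M) (v : TangentSpace 𝓘(ℝ, E) x) : coords x x v = v := by
  rw [coords_eq_mfderiv (mem_chartDomain x), mfderiv_extChartAt_self]
  rfl

theorem mdifferentiableAt_section_iff_coords {σ : Π x : M, TangentSpace 𝓘(ℝ, E) x} {x : M} :
    MDiffAt (T% σ) x ↔ MDifferentiableAt 𝓘(ℝ, E) 𝓘(ℝ, E) (fun y => coords x y (σ y)) x := by
  rw [mdifferentiableAt_section]
  apply Filter.EventuallyEq.mdifferentiableAt_iff
  filter_upwards [chartDomain_mem_nhds (E := E) x] with y hy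
  rw [coords_apply hy]

theorem mdifferentiableAt_frame (x : M) (a : E) : MDiffAt (T% (fun y => frame x y a)) x := by
  rw [mdifferentiableAt_section_iff_coords]
  refine (mdifferentiableAt_const (c := a)).congr_of_eventuallyEq ?_
  filter_upwards [chartDomain_mem_nhds (E := E) x] with y hy
  rw [coords_frame hy]

end Coordinates

/-! ### The Lie bracket in coordinates. -/

section LieBracket

variable {E : Type*} [NormedAddCommGroup E] [NormedSpace ℝ E]
  {M : Type*} [TopologicalSpace M] [ChartedSpace E M] [IsManifold 𝓘(ℝ, E) ∞ M]

theorem mpullbackWithin_extChartAt_symm_eq (A : Π x : M, TangentSpace 𝓘(ℝ, E) x) (x : M) {z : E}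
    (hz : z ∈ (extChartAt 𝓘(ℝ, E) x).target) :
    VectorField.mpullbackWithin 𝓘(ℝ, E) 𝓘(ℝ, E) (extChartAt 𝓘(ℝ, E) x).symm A
        (range 𝓘(ℝ, E)) z
      = coords x ((extChartAt 𝓘(ℝ, E) x).symm z) (A ((extChartAt 𝓘(ℝ, E) x).symm z)) := by
  have hy : (extChartAt 𝓘(ℝ, E) x).symm z ∈ chartDomain E x := by
    have := (extChartAt 𝓘(ℝ, E) x).map_target hz
    rwa [extChartAt_source] at this
  rw [VectorField.mpullbackWithin_apply, coords_eq_mfderiv hy]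
  have h1 := mfderiv_extChartAt_comp_mfderivWithin_extChartAt_symm (I := 𝓘(ℝ, E)) hz
  have h2 := mfderivWithin_extChartAt_symm_comp_mfderiv_extChartAt (I := 𝓘(ℝ, E)) hz
  rw [ContinuousLinearMap.inverse_eq h2 h1]
  rfl

theorem coords_mlieBracket {A B : Π x : M, TangentSpace 𝓘(ℝ, E) x} {x : M}
    (hA : MDiffAt (T% A) x) (hB : MDiffAt (T% B) x) :
    coords x x (VectorField.mlieBracket 𝓘(ℝ, E) A B x)
      = mvfderiv 𝓘(ℝ, E) (fun y => coords x y (B y)) x (A x)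
        - mvfderiv 𝓘(ℝ, E) (fun y => coords x y (A y)) x (B x) := by
  have key : ∀ A : Π x : M, TangentSpace 𝓘(ℝ, E) x,
      VectorField.mpullbackWithin 𝓘(ℝ, E) 𝓘(ℝ, E) (extChartAt 𝓘(ℝ, E) x).symm A
        (range 𝓘(ℝ, E)) =ᶠ[𝓝 (extChartAt 𝓘(ℝ, E) x x)]
      (fun y => coords x y (A y)) ∘ (extChartAt 𝓘(ℝ, E) x).symm := by
    intro A
    filter_upwards [extChartAt_target_mem_nhds (I := 𝓘(ℝ, E)) x] with z hz
    exact mpullbackWithin_extChartAt_symm_eq A x hz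
  -- The bracket is carried back by the derivative of the chart at its own centre, which is the
  -- identity.
  have hinv : ∀ w : E,
      ((mfderiv 𝓘(ℝ, E) 𝓘(ℝ, E) (extChartAt 𝓘(ℝ, E) x) x).inverse w : E) = w := by
    intro w
    rw [mfderiv_extChartAt_self]
    exact congrArg (fun B : E →L[ℝ] E => B w) ContinuousLinearMap.inverse_id
  have hs : (extChartAt 𝓘(ℝ, E) x).symm ⁻¹' univ ∩ range 𝓘(ℝ, E) = univ := by simp
  rw [coords_self, VectorField.mlieBracket, VectorField.mlieBracketWithin_apply,
    mvfderiv_apply (mdifferentiableAt_coords hA), mvfderiv_apply (mdifferentiableAt_coords hB), hs]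
  refine (hinv _).trans ((congrFun (VectorField.lieBracketWithin_univ (𝕜 := ℝ) (E := E)) _).trans ?_)
  refine (((key A).lieBracket_vectorField_eq (key B)).trans ?_)
  have hx : ∀ (A : Π x : M, TangentSpace 𝓘(ℝ, E) x) (y : M), y = x →
      (coords x y (A y) : E) = A x := by
    rintro A y rfl
    exact coords_self y (A y)
  simp only [VectorField.lieBracket_eq, Function.comp]
  rw [hx A _ (extChartAt_to_inv x), hx B _ (extChartAt_to_inv x)]

end LieBracket

/-! ### Gram form, Christoffel map and the Levi-Civita connection. -/

section Metric

variable {E : Type*} [NormedAddCommGroup E] [NormedSpace ℝ E]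
  {M : Type*} [TopologicalSpace M] [ChartedSpace E M] [IsManifold 𝓘(ℝ, E) ∞ M]
  [RiemannianBundle (fun x : M => TangentSpace 𝓘(ℝ, E) x)]

/-- The Gram form at `y` of the coordinate frame of the preferred chart at `x`. -/
def gram (x y : M) : E →L[ℝ] E →L[ℝ] ℝ :=
  (innerSL ℝ (E := TangentSpace 𝓘(ℝ, E) y)).bilinearComp (frame x y) (frame x y)

theorem gram_apply (x y : M) (a b : E) : gram x y a b = ⟪frame x y a, frame x y b⟫_ℝ := rfl

theorem gram_coords {x y : M} (hy : y ∈ chartDomain E x) (v w : TangentSpace 𝓘(ℝ, E) y) :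
    gram x y (coords x y v) (coords x y w) = ⟪v, w⟫_ℝ := by
  rw [gram_apply, frame_coords hy, frame_coords hy]

/-- The derivative of the Gram form of the coordinate frame. -/
def gramDeriv (x : M) (u v w : TangentSpace 𝓘(ℝ, E) x) : ℝ :=
  mvfderiv 𝓘(ℝ, E) (gram x) x u (coords x x v) (coords x x w)

theorem gramDeriv_add₁ (x : M) (u u' v w : TangentSpace 𝓘(ℝ, E) x) :
    gramDeriv x (u + u') v w = gramDeriv x u v w + gramDeriv x u' v w := by
  rw [gramDeriv, ContinuousLinearMap.map_add]
  rfl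

theorem gramDeriv_smul₁ (x : M) (c : ℝ) (u v w : TangentSpace 𝓘(ℝ, E) x) :
    gramDeriv x (c • u) v w = c * gramDeriv x u v w := by
  rw [gramDeriv, ContinuousLinearMap.map_smul]
  rfl

theorem gramDeriv_add₂ (x : M) (u v v' w : TangentSpace 𝓘(ℝ, E) x) :
    gramDeriv x u (v + v') w = gramDeriv x u v w + gramDeriv x u v' w := by
  rw [gramDeriv, ContinuousLinearMap.map_add, ContinuousLinearMap.map_add]
  rfl

theorem gramDeriv_smul₂ (x : M) (c : ℝ) (u v w : TangentSpace 𝓘(ℝ, E) x) :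
    gramDeriv x u (c • v) w = c * gramDeriv x u v w := by
  rw [gramDeriv, ContinuousLinearMap.map_smul, ContinuousLinearMap.map_smul]
  rfl

theorem gramDeriv_add₃ (x : M) (u v w w' : TangentSpace 𝓘(ℝ, E) x) :
    gramDeriv x u v (w + w') = gramDeriv x u v w + gramDeriv x u v w' := by
  rw [gramDeriv, ContinuousLinearMap.map_add, ContinuousLinearMap.map_add]
  rfl

theorem gramDeriv_smul₃ (x : M) (c : ℝ) (u v w : TangentSpace 𝓘(ℝ, E) x) :
    gramDeriv x u v (c • w) = c * gramDeriv x u v w := by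
  rw [gramDeriv, ContinuousLinearMap.map_smul, ContinuousLinearMap.map_smul]
  rfl

variable [FiniteDimensional ℝ E]
  [IsContMDiffRiemannianBundle 𝓘(ℝ, E) ∞ E (fun x : M => TangentSpace 𝓘(ℝ, E) x)]

theorem mdifferentiableAt_gram (x : M) :
    MDifferentiableAt 𝓘(ℝ, E) 𝓘(ℝ, E →L[ℝ] E →L[ℝ] ℝ) (gram (E := E) x) x := by
  have : IsContMDiffRiemannianBundle 𝓘(ℝ, E) 1 E (fun x : M => TangentSpace 𝓘(ℝ, E) x) :=
    IsContMDiffRiemannianBundle.of_le (n := ∞) (by norm_num)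
  refine mdifferentiableAt_clm_of_apply fun a => mdifferentiableAt_clm_of_apply fun b => ?_
  exact MDifferentiableAt.inner_bundle (F := E) (E := fun x : M => TangentSpace 𝓘(ℝ, E) x)
    (mdifferentiableAt_frame x a) (mdifferentiableAt_frame x b)

theorem mvfderiv_inner_extend (x : M) (u v w : TangentSpace 𝓘(ℝ, E) x) :
    mvfderiv 𝓘(ℝ, E) (fun y : M => ⟪FiberBundle.extend E v y, FiberBundle.extend E w y⟫_ℝ) x u
      = gramDeriv x u v w := by
  have h : (fun y : M => ⟪FiberBundle.extend E v y, FiberBundle.extend E w y⟫_ℝ) =ᶠ[𝓝 x]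
      fun y => gram x y (coords x x v) (coords x x w) := by
    filter_upwards [chartDomain_mem_nhds (E := E) x] with y hy
    rw [gram_apply, extend_eq_frame v hy, extend_eq_frame w hy]
  have hg := mdifferentiableAt_gram (E := E) x
  rw [mvfderiv_congr h, mvfderiv_clm_apply (hg.clm_apply mdifferentiableAt_const)
    mdifferentiableAt_const, mvfderiv_clm_apply hg mdifferentiableAt_const,
    mvfderiv_const, mvfderiv_const]
  simp [gramDeriv]

theorem koszul_eq (x : M) (u v w : TangentSpace 𝓘(ℝ, E) x) :
    koszul x u v w = (gramDeriv x u v w + gramDeriv x v u w - gramDeriv x w u v) / 2 := by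
  simp only [koszul, mvfderiv_inner_extend]

theorem gramDeriv_comm (x : M) (u v w : TangentSpace 𝓘(ℝ, E) x) :
    gramDeriv x u v w = gramDeriv x u w v := by
  simp only [← mvfderiv_inner_extend]
  simp only [real_inner_comm]

/-- Written through `gramDeriv`, the Koszul expression is trilinear, so it is recovered from its
values on the orthonormal basis used to define the Christoffel map. -/
theorem inner_christoffel (x : M) (u v w : TangentSpace 𝓘(ℝ, E) x) :
    ⟪christoffel x v u, w⟫_ℝ = koszul x u v w := by
  set b := stdOrthonormalBasis ℝ (TangentSpace 𝓘(ℝ, E) x) with hb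
  have expand : ∀ (f : TangentSpace 𝓘(ℝ, E) x →ₗ[ℝ] ℝ) (v : TangentSpace 𝓘(ℝ, E) x),
      ∑ i, ⟪b i, v⟫_ℝ * f (b i) = f v := by
    intro f v
    conv_rhs => rw [← b.sum_repr' v]
    simp
  have hu : ∀ v w, ∑ i, ⟪b i, u⟫_ℝ * koszul x (b i) v w = koszul x u v w := fun v w =>
    expand { toFun := fun u => koszul x u v w
             map_add' := fun u u' => by
               simp only [koszul_eq, gramDeriv_add₁, gramDeriv_add₂]; ring
             map_smul' := fun c u => by
               simp only [koszul_eq, gramDeriv_smul₁, gramDeriv_smul₂,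
                 RingHom.id_apply, smul_eq_mul]
               ring } u
  have hv : ∀ u w, ∑ j, ⟪b j, v⟫_ℝ * koszul x u (b j) w = koszul x u v w := fun u w =>
    expand { toFun := fun v => koszul x u v w
             map_add' := fun u u' => by
               simp only [koszul_eq, gramDeriv_add₁, gramDeriv_add₂, gramDeriv_add₃]; ring
             map_smul' := fun c u => by
               simp only [koszul_eq, gramDeriv_smul₁, gramDeriv_smul₂, gramDeriv_smul₃,
                 RingHom.id_apply, smul_eq_mul]
               ring } v
  have hw : ∀ u v, ∑ k, ⟪b k, w⟫_ℝ * koszul x u v (b k) = koszul x u v w := fun u v =>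
    expand { toFun := fun w => koszul x u v w
             map_add' := fun u u' => by
               simp only [koszul_eq, gramDeriv_add₁, gramDeriv_add₃]; ring
             map_smul' := fun c u => by
               simp only [koszul_eq, gramDeriv_smul₁, gramDeriv_smul₃,
                 RingHom.id_apply, smul_eq_mul]
               ring } w
  calc ⟪christoffel x v u, w⟫_ℝ
      = ∑ i, ∑ j, ∑ k, ⟪b j, v⟫_ℝ * koszul x (b i) (b j) (b k) * (⟪b i, u⟫_ℝ * ⟪b k, w⟫_ℝ) := by
        simp [christoffel, ← hb, sum_inner, inner_smul_left]
    _ = ∑ i, ⟪b i, u⟫_ℝ * ∑ j, ⟪b j, v⟫_ℝ * ∑ k, ⟪b k, w⟫_ℝ * koszul x (b i) (b j) (b k) := by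
        simp only [Finset.mul_sum]
        refine Finset.sum_congr rfl fun i _ => Finset.sum_congr rfl fun j _ =>
          Finset.sum_congr rfl fun k _ => ?_
        ring
    _ = koszul x u v w := by simp only [hw, hv, hu]

theorem christoffel_comm (x : M) (u v : TangentSpace 𝓘(ℝ, E) x) :
    christoffel x v u = christoffel x u v := by
  refine ext_inner_right ℝ fun w => ?_
  rw [inner_christoffel, inner_christoffel, koszul_eq, koszul_eq, gramDeriv_comm x w]
  ring

/-- Metric compatibility at a point: in the sum of the two Koszul expressions the derivatives along
`v` and `w` cancel. -/
theorem inner_christoffel_add (x : M) (u v w : TangentSpace 𝓘(ℝ, E) x) :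
    ⟪christoffel x v u, w⟫_ℝ + ⟪v, christoffel x w u⟫_ℝ = gramDeriv x u v w := by
  rw [real_inner_comm _ v, inner_christoffel, inner_christoffel, koszul_eq, koszul_eq,
    gramDeriv_comm x u w]
  ring

omit [IsContMDiffRiemannianBundle 𝓘(ℝ, E) ∞ E (fun x : M => TangentSpace 𝓘(ℝ, E) x)] in
theorem leviCivita_apply (σ : Π x : M, TangentSpace 𝓘(ℝ, E) x) (x : M)
    (u : TangentSpace 𝓘(ℝ, E) x) :
    leviCivita M σ x u = ofCoords x (mvfderiv 𝓘(ℝ, E) (fun y => coords x y (σ y)) x u)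
      + christoffel x (σ x) u := rfl

omit [IsContMDiffRiemannianBundle 𝓘(ℝ, E) ∞ E (fun x : M => TangentSpace 𝓘(ℝ, E) x)] in
theorem leviCivita_extend (x : M) (v u : TangentSpace 𝓘(ℝ, E) x) :
    leviCivita M (FiberBundle.extend E v) x u = christoffel x v u := by
  have h : (fun y : M => coords x y (FiberBundle.extend E v y)) =ᶠ[𝓝 x]
      fun _ => coords x x v := by
    filter_upwards [chartDomain_mem_nhds (E := E) x] with y hy
    rw [extend_eq_frame v hy, coords_frame hy]
  rw [leviCivita_apply, mvfderiv_congr h, mvfderiv_const]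
  simp

/-- Vanishing torsion: the Christoffel terms cancel by symmetry, leaving the coordinate formula of
the bracket. -/
theorem leviCivita_sub_eq_mlieBracket {A B : Π x : M, TangentSpace 𝓘(ℝ, E) x} {x : M}
    (hA : MDiffAt (T% A) x) (hB : MDiffAt (T% B) x) :
    leviCivita M B x (A x) - leviCivita M A x (B x) = VectorField.mlieBracket 𝓘(ℝ, E) A B x := by
  rw [leviCivita_apply, leviCivita_apply, christoffel_comm x (A x) (B x), add_sub_add_right_eq_sub,
    ← map_sub, ← coords_mlieBracket hA hB, ofCoords_coords]

end Metric

/-! ### Vector fields along a map. -/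

section FieldsAlong

theorem mvfderiv_comp_mfderiv {E : Type*} [NormedAddCommGroup E] [NormedSpace ℝ E]
    {L : Type*} [TopologicalSpace L] [ChartedSpace E L]
    {F : Type*} [NormedAddCommGroup F] [NormedSpace ℝ F]
    {K : Type*} [TopologicalSpace K] [ChartedSpace F K]
    {H : Type*} [NormedAddCommGroup H] [NormedSpace ℝ H] {G : L → K} {g : K → H} {p : L}
    (hg : MDifferentiableAt 𝓘(ℝ, F) 𝓘(ℝ, H) g (G p))
    (hG : MDifferentiableAt 𝓘(ℝ, E) 𝓘(ℝ, F) G p) (u : TangentSpace 𝓘(ℝ, E) p) :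
    mvfderiv 𝓘(ℝ, E) (fun q => g (G q)) p u
      = mvfderiv 𝓘(ℝ, F) g (G p) (mfderiv 𝓘(ℝ, E) 𝓘(ℝ, F) G p u) :=
  mfderiv_comp_apply p hg hG u

theorem eventually_mem_chartDomain {L : Type*} [TopologicalSpace L]
    {F : Type*} [NormedAddCommGroup F] {K : Type*} [TopologicalSpace K] [ChartedSpace F K]
    {G : L → K} {p : L} (hG : ContinuousAt G p) : ∀ᶠ q in 𝓝 p, G q ∈ chartDomain F (G p) :=
  hG.preimage_mem_nhds (chartDomain_mem_nhds (G p))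

variable {E : Type*} [NormedAddCommGroup E] [NormedSpace ℝ E]
  {L : Type*} [TopologicalSpace L] [ChartedSpace E L]
  {F : Type*} [NormedAddCommGroup F] [NormedSpace ℝ F]
  {K : Type*} [TopologicalSpace K] [ChartedSpace F K] [IsManifold 𝓘(ℝ, F) ∞ K]

variable (E) in
/-- Differentiability at `p` of a vector field `V` along `G`, in the preferred chart at `G p`. -/
def DifferentiableAlong (G : L → K) (V : Π p : L, TangentSpace 𝓘(ℝ, F) (G p)) (p : L) : Prop :=
  MDifferentiableAt 𝓘(ℝ, E) 𝓘(ℝ, F) (fun q => coords (G p) (G q) (V q)) p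

variable {G : L → K} {V W : Π p : L, TangentSpace 𝓘(ℝ, F) (G p)} {p : L}

theorem DifferentiableAlong.of_mdifferentiableAt (hG : ContinuousAt G p)
    (hV : MDifferentiableAt 𝓘(ℝ, E) 𝓘(ℝ, F).tangent
      (fun q => (⟨G q, V q⟩ : TangentBundle 𝓘(ℝ, F) K)) p) :
    DifferentiableAlong E G V p := by
  refine ((mdifferentiableAt_totalSpace 𝓘(ℝ, F) _).1 hV).2.congr_of_eventuallyEq ?_
  filter_upwards [eventually_mem_chartDomain (F := F) hG] with q hq
  exact coords_apply hq _

theorem DifferentiableAlong.sub (hV : DifferentiableAlong E G V p)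
    (hW : DifferentiableAlong E G W p) : DifferentiableAlong E G (fun q => V q - W q) p := by
  have h := MDifferentiableAt.sub hV hW
  refine h.congr_of_eventuallyEq (Filter.Eventually.of_forall fun q => ?_)
  simp

theorem DifferentiableAlong.comp {σ : Π x : K, TangentSpace 𝓘(ℝ, F) x}
    (hG : MDifferentiableAt 𝓘(ℝ, E) 𝓘(ℝ, F) G p) (hσ : MDiffAt (T% σ) (G p)) :
    DifferentiableAlong E G (fun q => σ (G q)) p :=
  MDifferentiableAt.comp p (mdifferentiableAt_coords hσ) hG

/-! ### The pullback connection and its compatibility with the metric. -/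

section Connection

variable [FiniteDimensional ℝ F]
  [RiemannianBundle (fun x : K => TangentSpace 𝓘(ℝ, F) x)]

theorem pullbackConnection_apply (V : Π p : L, TangentSpace 𝓘(ℝ, F) (G p)) (p : L)
    (u : TangentSpace 𝓘(ℝ, E) p) :
    pullbackConnection E F G V p u
      = ofCoords (G p) (mvfderiv 𝓘(ℝ, E) (fun q => coords (G p) (G q) (V q)) p u)
        + christoffel (G p) (V p) (push E F G p u) := by
  have h : pullbackConnection E F G V p u
      = ofCoords (G p) (mvfderiv 𝓘(ℝ, E) (fun q => coords (G p) (G q) (V q)) p u)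
        + leviCivita K (FiberBundle.extend F (V p)) (G p) (push E F G p u) := rfl
  rw [h, leviCivita_extend]

theorem christoffel_add (x : K) (v w : TangentSpace 𝓘(ℝ, F) x) :
    christoffel x (v + w) = christoffel x v + christoffel x w := by
  simp only [christoffel, inner_add_right, add_mul, add_smul, Finset.sum_add_distrib]

theorem christoffel_smul (x : K) (c : ℝ) (v : TangentSpace 𝓘(ℝ, F) x) :
    christoffel x (c • v) = c • christoffel x v := by
  simp only [christoffel, inner_smul_right, mul_assoc, mul_smul, Finset.smul_sum]

theorem pullbackConnection_congr (h : ∀ᶠ q in 𝓝 p, V q = W q) :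
    pullbackConnection E F G V p = pullbackConnection E F G W p := by
  ext u
  have h1 : (fun q => coords (G p) (G q) (V q)) =ᶠ[𝓝 p] fun q => coords (G p) (G q) (W q) := by
    filter_upwards [h] with q hq
    rw [hq]
  rw [pullbackConnection_apply, pullbackConnection_apply, mvfderiv_congr h1, h.self_of_nhds]

theorem pullbackConnection_add (hV : DifferentiableAlong E G V p)
    (hW : DifferentiableAlong E G W p) (u : TangentSpace 𝓘(ℝ, E) p) :
    pullbackConnection E F G (fun q => V q + W q) p u
      = pullbackConnection E F G V p u + pullbackConnection E F G W p u := by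
  have h : (fun q => coords (G p) (G q) (V q + W q))
      = (fun q => coords (G p) (G q) (V q)) + fun q => coords (G p) (G q) (W q) := by
    ext q
    simp
  rw [pullbackConnection_apply, h, mvfderiv_add hV hW, christoffel_add, pullbackConnection_apply,
    pullbackConnection_apply, add_apply, add_apply, map_add]
  abel

theorem pullbackConnection_smul {f : L → ℝ} (hf : MDifferentiableAt 𝓘(ℝ, E) 𝓘(ℝ) f p)
    (hV : DifferentiableAlong E G V p) (u : TangentSpace 𝓘(ℝ, E) p) :
    pullbackConnection E F G (fun q => f q • V q) p u
      = mvfderiv 𝓘(ℝ, E) f p u • V p + f p • pullbackConnection E F G V p u := by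
  have h : (fun q => coords (G p) (G q) (f q • V q))
      = f • fun q => coords (G p) (G q) (V q) := by
    ext q
    simp
  simp only [pullbackConnection_apply, christoffel_smul, h, mvfderiv_smul hf hV]
  simp [ofCoords_coords]
  abel

theorem pullbackConnection_comp {σ : Π x : K, TangentSpace 𝓘(ℝ, F) x}
    (hG : MDifferentiableAt 𝓘(ℝ, E) 𝓘(ℝ, F) G p) (hσ : MDiffAt (T% σ) (G p))
    (u : TangentSpace 𝓘(ℝ, E) p) :
    pullbackConnection E F G (fun q => σ (G q)) p u = leviCivita K σ (G p) (push E F G p u) := by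
  have h := mvfderiv_comp_mfderiv (mdifferentiableAt_coords (E := F) hσ) hG u
  rw [pullbackConnection_apply, leviCivita_apply]
  exact congrArg (fun a => ofCoords (G p) a + christoffel (G p) (σ (G p)) (push E F G p u)) h

variable [IsContMDiffRiemannianBundle 𝓘(ℝ, F) ∞ F (fun x : K => TangentSpace 𝓘(ℝ, F) x)]

/-- The pullback connection is compatible with the metric of the target. -/
theorem mvfderiv_inner_along (hG : MDifferentiableAt 𝓘(ℝ, E) 𝓘(ℝ, F) G p)
    (hV : DifferentiableAlong E G V p) (hW : DifferentiableAlong E G W p)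
    (u : TangentSpace 𝓘(ℝ, E) p) :
    mvfderiv 𝓘(ℝ, E) (fun q => ⟪V q, W q⟫_ℝ) p u
      = ⟪pullbackConnection E F G V p u, W p⟫_ℝ + ⟪V p, pullbackConnection E F G W p u⟫_ℝ := by
  have h : (fun q => ⟪V q, W q⟫_ℝ) =ᶠ[𝓝 p]
      fun q => gram (G p) (G q) (coords (G p) (G q) (V q)) (coords (G p) (G q) (W q)) := by
    filter_upwards [eventually_mem_chartDomain (F := F) hG.continuousAt] with q hq
    rw [gram_coords hq]
  have hg : MDifferentiableAt 𝓘(ℝ, E) 𝓘(ℝ, F →L[ℝ] F →L[ℝ] ℝ) (fun q => gram (G p) (G q)) p :=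
    MDifferentiableAt.comp (g := gram (G p)) p (mdifferentiableAt_gram (E := F) (G p)) hG
  have hd : mvfderiv 𝓘(ℝ, E) (fun q => gram (G p) (G q)) p u (coords (G p) (G p) (V p))
      (coords (G p) (G p) (W p)) = gramDeriv (G p) (push E F G p u) (V p) (W p) := by
    have := mvfderiv_comp_mfderiv (mdifferentiableAt_gram (E := F) (G p)) hG u
    exact congrArg (fun B : F →L[ℝ] F →L[ℝ] ℝ =>
      B (coords (G p) (G p) (V p)) (coords (G p) (G p) (W p))) this
  rw [mvfderiv_congr h, mvfderiv_clm_apply (hg.clm_apply hV) hW, mvfderiv_clm_apply hg hV,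
    add_apply, hd, pullbackConnection_apply, pullbackConnection_apply,
    inner_add_left, inner_add_right, ← inner_christoffel_add, gram_apply, gram_apply, frame_self,
    ofCoords_coords, ofCoords_coords]
  ring

theorem inner_pullbackConnection_of_inner_eq_zero (hG : MDifferentiableAt 𝓘(ℝ, E) 𝓘(ℝ, F) G p)
    (hV : DifferentiableAlong E G V p) (hW : DifferentiableAlong E G W p)
    (h : ∀ q, ⟪V q, W q⟫_ℝ = 0) (u : TangentSpace 𝓘(ℝ, E) p) :
    ⟪pullbackConnection E F G V p u, W p⟫_ℝ = - ⟪V p, pullbackConnection E F G W p u⟫_ℝ := by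
  have h1 := mvfderiv_inner_along hG hV hW u
  have h2 : (fun q => ⟪V q, W q⟫_ℝ) = fun _ => 0 := funext h
  rw [h2, mvfderiv_const] at h1
  have h3 : (0 : TangentSpace 𝓘(ℝ, E) p →L[ℝ] ℝ) u = 0 := rfl
  linarith

end Connection

/-! ### Parallel complex structures along a map. -/

section Endomorphism

variable {J : Π x : K, TangentSpace 𝓘(ℝ, F) x →L[ℝ] TangentSpace 𝓘(ℝ, F) x}

/-- The matrix of an endomorphism field at `y` in the coordinate frame of the preferred chart
at `x`. -/
def endCoords (J : Π x : K, TangentSpace 𝓘(ℝ, F) x →L[ℝ] TangentSpace 𝓘(ℝ, F) x) (x y : K) :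
    F →L[ℝ] F :=
  coords x y ∘L J y ∘L frame x y

theorem endCoords_coords {x y : K} (hy : y ∈ chartDomain F x) (v : TangentSpace 𝓘(ℝ, F) y) :
    endCoords J x y (coords x y v) = coords x y (J y v) := by
  simp [endCoords, frame_coords hy]

theorem eventually_coords_endomorphism (hG : ContinuousAt G p) :
    (fun q => coords (G p) (G q) (J (G q) (V q)))
      =ᶠ[𝓝 p] fun q => endCoords J (G p) (G q) (coords (G p) (G q) (V q)) := by
  filter_upwards [eventually_mem_chartDomain (F := F) hG] with q hq
  rw [endCoords_coords hq]

variable [FiniteDimensional ℝ F]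

theorem mdifferentiableAt_endCoords
    (hJ : ContMDiff 𝓘(ℝ, F) (𝓘(ℝ, F).prod 𝓘(ℝ, F →L[ℝ] F)) ∞
      (fun x => TotalSpace.mk' (F →L[ℝ] F)
        (E := fun x : K => TangentSpace 𝓘(ℝ, F) x →L[ℝ] TangentSpace 𝓘(ℝ, F) x) x (J x)))
    (x : K) : MDifferentiableAt 𝓘(ℝ, F) 𝓘(ℝ, F →L[ℝ] F) (endCoords J x) x := by
  refine mdifferentiableAt_clm_of_apply fun a => ?_
  have h : MDiffAt (T% (fun y => J y (frame x y a))) x :=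
    MDifferentiableAt.clm_bundle_apply (F₁ := F) (F₂ := F)
      (E₁ := fun x : K => TangentSpace 𝓘(ℝ, F) x) (E₂ := fun x : K => TangentSpace 𝓘(ℝ, F) x)
      ((hJ x).mdifferentiableAt (by simp)) (mdifferentiableAt_frame x a)
  exact mdifferentiableAt_coords h

theorem DifferentiableAlong.endomorphism
    (hJ : ContMDiff 𝓘(ℝ, F) (𝓘(ℝ, F).prod 𝓘(ℝ, F →L[ℝ] F)) ∞
      (fun x => TotalSpace.mk' (F →L[ℝ] F)
        (E := fun x : K => TangentSpace 𝓘(ℝ, F) x →L[ℝ] TangentSpace 𝓘(ℝ, F) x) x (J x)))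
    (hG : MDifferentiableAt 𝓘(ℝ, E) 𝓘(ℝ, F) G p)
    (hV : DifferentiableAlong E G V p) : DifferentiableAlong E G (fun q => J (G q) (V q)) p := by
  have hA : MDifferentiableAt 𝓘(ℝ, E) 𝓘(ℝ, F →L[ℝ] F) (fun q => endCoords J (G p) (G q)) p :=
    MDifferentiableAt.comp p (mdifferentiableAt_endCoords (F := F) hJ (G p)) hG
  exact (hA.clm_apply hV).congr_of_eventuallyEq (eventually_coords_endomorphism hG.continuousAt)

/-- The complex structure of a Kähler manifold is parallel for the pullback connection. -/
theorem IsKahler.pullbackConnection [RiemannianBundle (fun x : K => TangentSpace 𝓘(ℝ, F) x)]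
    (hJ : IsKahler (E := F) J) (hG : MDifferentiableAt 𝓘(ℝ, E) 𝓘(ℝ, F) G p)
    (hV : DifferentiableAlong E G V p) (u : TangentSpace 𝓘(ℝ, E) p) :
    pullbackConnection E F G (fun q => J (G q) (V q)) p u
      = J (G p) (pullbackConnection E F G V p u) := by
  have hJ' := mdifferentiableAt_endCoords (F := F) hJ.smooth (G p)
  have hA : MDifferentiableAt 𝓘(ℝ, E) 𝓘(ℝ, F →L[ℝ] F) (fun q => endCoords J (G p) (G q)) p :=
    MDifferentiableAt.comp p hJ' hG
  have hd : mvfderiv 𝓘(ℝ, E) (fun q => endCoords J (G p) (G q)) p u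
      = mvfderiv 𝓘(ℝ, F) (endCoords J (G p)) (G p) (push E F G p u) :=
    mvfderiv_comp_mfderiv hJ' hG u
  have hext := mdifferentiableAt_frame (G p) (coords (G p) (G p) (V p))
  -- Testing parallelism on a field with constant coordinates isolates the relation between the
  -- derivative of the matrix of `J` and the Christoffel map; the chain rule then transports it
  -- along `G`.
  have hpar := hJ.parallel _ (G p) hext (push E F G p u)
  have h1 : (fun y => coords (G p) y (frame (G p) y (coords (G p) (G p) (V p))))
      =ᶠ[𝓝 (G p)] fun _ => coords (G p) (G p) (V p) := by
    filter_upwards [chartDomain_mem_nhds (E := F) (G p)] with y hy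
    rw [coords_frame hy]
  have h2 : (fun y => coords (G p) y (J y (frame (G p) y (coords (G p) (G p) (V p)))))
      = fun y => endCoords J (G p) y (coords (G p) (G p) (V p)) := rfl
  rw [leviCivita_apply, leviCivita_apply, mvfderiv_congr h1, mvfderiv_const, h2,
    mvfderiv_clm_apply hJ' mdifferentiableAt_const, mvfderiv_const,
    frame_coords (mem_chartDomain (G p))] at hpar
  simp only [zero_apply, map_zero, add_zero, zero_add] at hpar
  have h3 : ofCoords (G p) (endCoords J (G p) (G p)
      (mvfderiv 𝓘(ℝ, E) (fun q => coords (G p) (G q) (V q)) p u))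
      = J (G p) (ofCoords (G p) (mvfderiv 𝓘(ℝ, E) (fun q => coords (G p) (G q) (V q)) p u)) := by
    simp [endCoords, frame_self, ofCoords_coords]
  rw [pullbackConnection_apply, pullbackConnection_apply,
    mvfderiv_congr (eventually_coords_endomorphism hG.continuousAt), mvfderiv_clm_apply hA hV, hd,
    map_add, map_add, h3, ← hpar]
  abel

end Endomorphism

/-! ### The differential in coordinates and the symmetry of the second fundamental form. -/

section Differential

variable [IsManifold 𝓘(ℝ, E) ∞ L]

/-- The matrix of `G_*` at `q` in the coordinate frames of the preferred charts at `p` and `G p`. -/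
def pushCoords (G : L → K) (p q : L) : E →L[ℝ] F :=
  coords (G p) (G q) ∘L push E F G q ∘L frame p q

theorem pushCoords_coords {q : L} (hq : q ∈ chartDomain E p) (v : TangentSpace 𝓘(ℝ, E) q) :
    pushCoords G p q (coords p q v) = coords (G p) (G q) (push E F G q v) := by
  simp [pushCoords, frame_coords hq]

variable (E F) in
/-- The map `G` read in the preferred charts at `p` and `G p`. -/
def inCharts (G : L → K) (p : L) : E → F :=
  extChartAt 𝓘(ℝ, F) (G p) ∘ G ∘ (extChartAt 𝓘(ℝ, E) p).symm

theorem contDiffAt_inCharts (hG : ContMDiff 𝓘(ℝ, E) 𝓘(ℝ, F) ∞ G) {q : L}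
    (hq : q ∈ chartDomain E p) (hGq : G q ∈ chartDomain F (G p)) :
    ContDiffAt ℝ ∞ (inCharts E F G p) (extChartAt 𝓘(ℝ, E) p q) := by
  have hq' : q ∈ (extChartAt 𝓘(ℝ, E) p).source := by rwa [extChartAt_source]
  have h0 : (extChartAt 𝓘(ℝ, E) p).symm (extChartAt 𝓘(ℝ, E) p q) = q :=
    (extChartAt 𝓘(ℝ, E) p).left_inv hq'
  have h1 : ContMDiffAt 𝓘(ℝ, E) 𝓘(ℝ, E) ∞ (extChartAt 𝓘(ℝ, E) p).symm
      (extChartAt 𝓘(ℝ, E) p q) :=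
    (contMDiffOn_extChartAt_symm p).contMDiffAt (extChartAt_target_mem_nhds' (by
      exact (extChartAt 𝓘(ℝ, E) p).map_source hq'))
  have h2 : ContMDiffAt 𝓘(ℝ, F) 𝓘(ℝ, F) ∞ (extChartAt 𝓘(ℝ, F) (G p)) (G q) :=
    contMDiffAt_extChartAt' hGq
  have h3 : ContMDiffAt 𝓘(ℝ, E) 𝓘(ℝ, F) ∞ (G ∘ (extChartAt 𝓘(ℝ, E) p).symm)
      (extChartAt 𝓘(ℝ, E) p q) := hG.contMDiffAt.comp _ h1
  refine ContMDiffAt.contDiffAt (ContMDiffAt.comp _ ?_ h3)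
  rwa [Function.comp, h0]

theorem pushCoords_eq_fderiv (hG : ContMDiff 𝓘(ℝ, E) 𝓘(ℝ, F) ∞ G) {q : L}
    (hq : q ∈ chartDomain E p) (hGq : G q ∈ chartDomain F (G p)) :
    pushCoords G p q = fderiv ℝ (inCharts E F G p) (extChartAt 𝓘(ℝ, E) p q) := by
  have hd := (contDiffAt_inCharts hG hq hGq).differentiableAt (by simp)
  have hGd : MDifferentiableAt 𝓘(ℝ, E) 𝓘(ℝ, F) G q := (hG q).mdifferentiableAt (by simp)
  have heq : (fun q => extChartAt 𝓘(ℝ, F) (G p) (G q))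
      =ᶠ[𝓝 q] fun q => inCharts E F G p (extChartAt 𝓘(ℝ, E) p q) := by
    filter_upwards [(chartAt E p).open_source.mem_nhds hq] with r hr
    rw [inCharts, Function.comp, Function.comp, (extChartAt 𝓘(ℝ, E) p).left_inv
      (by rwa [extChartAt_source])]
  ext a
  have h1 := mvfderiv_comp_mfderiv (E := E) (F := F)
    (mdifferentiableAt_extChartAt (I := 𝓘(ℝ, F)) hGq) hGd (frame p q a)
  have h2 := mvfderiv_comp_mfderiv (E := E) (F := E) hd.mdifferentiableAt
    (mdifferentiableAt_extChartAt (I := 𝓘(ℝ, E)) hq) (frame p q a)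
  rw [mvfderiv_congr heq, h2] at h1
  have h3 : mfderiv 𝓘(ℝ, E) 𝓘(ℝ, E) (extChartAt 𝓘(ℝ, E) p) q (frame p q a) = a := by
    rw [← coords_eq_mfderiv hq]
    exact coords_frame hq a
  have h4 : (pushCoords (F := F) G p q a : F)
      = mfderiv 𝓘(ℝ, F) 𝓘(ℝ, F) (extChartAt 𝓘(ℝ, F) (G p)) (G q)
        (mfderiv 𝓘(ℝ, E) 𝓘(ℝ, F) G q (frame p q a)) := by
    rw [← coords_eq_mfderiv (E := F) hGq]
    rfl
  rw [h4]
  refine h1.symm.trans ?_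
  rw [h3]
  exact congrArg (fun A : E →L[ℝ] F => A a) mfderiv_eq_fderiv

theorem eventually_pushCoords_eq (hG : ContMDiff 𝓘(ℝ, E) 𝓘(ℝ, F) ∞ G) (p : L) :
    pushCoords (E := E) (F := F) G p =ᶠ[𝓝 p] fun q =>
      fderiv ℝ (inCharts E F G p) (extChartAt 𝓘(ℝ, E) p q) := by
  filter_upwards [chartDomain_mem_nhds (E := E) p,
    eventually_mem_chartDomain (F := F) hG.continuous.continuousAt] with q hq hGq
  exact pushCoords_eq_fderiv hG hq hGq

theorem differentiableAt_fderiv_inCharts (hG : ContMDiff 𝓘(ℝ, E) 𝓘(ℝ, F) ∞ G) (p : L) :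
    DifferentiableAt ℝ (fderiv ℝ (inCharts E F G p)) (extChartAt 𝓘(ℝ, E) p p) :=
  ((contDiffAt_inCharts hG (mem_chartDomain p) (mem_chartDomain (G p))).fderiv_right
    (m := 1) (by norm_cast)).differentiableAt (by simp)

theorem mdifferentiableAt_pushCoords (hG : ContMDiff 𝓘(ℝ, E) 𝓘(ℝ, F) ∞ G) (p : L) :
    MDifferentiableAt 𝓘(ℝ, E) 𝓘(ℝ, E →L[ℝ] F) (pushCoords (E := E) (F := F) G p) p := by
  refine MDifferentiableAt.congr_of_eventuallyEq ?_ (eventually_pushCoords_eq hG p)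
  exact (differentiableAt_fderiv_inCharts hG p).comp_mdifferentiableAt
    (mdifferentiableAt_extChartAt (mem_chart_source E p))

/-- Near `p` the matrix of `G_*` is the Jacobian of `G` in charts, so its derivative is a Hessian,
and second derivatives commute. -/
theorem mvfderiv_pushCoords_comm (hG : ContMDiff 𝓘(ℝ, E) 𝓘(ℝ, F) ∞ G) (p : L)
    (u v : TangentSpace 𝓘(ℝ, E) p) :
    mvfderiv 𝓘(ℝ, E) (pushCoords (F := F) G p) p u (coords p p v)
      = mvfderiv 𝓘(ℝ, E) (pushCoords (F := F) G p) p v (coords p p u) := by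
  have key : ∀ u v : TangentSpace 𝓘(ℝ, E) p,
      mvfderiv 𝓘(ℝ, E) (pushCoords (F := F) G p) p u (coords p p v)
        = fderiv ℝ (fderiv ℝ (inCharts E F G p)) (extChartAt 𝓘(ℝ, E) p p) u v := by
    intro u v
    rw [mvfderiv_congr (eventually_pushCoords_eq hG p),
      mvfderiv_comp_mfderiv (differentiableAt_fderiv_inCharts hG p).mdifferentiableAt
      (mdifferentiableAt_extChartAt (mem_chart_source E p)), mfderiv_extChartAt_self, coords_self]
    exact congrArg (fun A : E →L[ℝ] E →L[ℝ] F => A u v) mfderiv_eq_fderiv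
  rw [key, key]
  exact ((contDiffAt_inCharts hG (mem_chartDomain p)
    (mem_chartDomain (G p))).isSymmSndFDerivAt (by
      rw [minSmoothness_of_isRCLikeNormedField]
      exact WithTop.coe_le_coe.2 le_top)).eq u v

theorem eventually_coords_push (G : L → K) (Y : Π p : L, TangentSpace 𝓘(ℝ, E) p) (p : L) :
    (fun q => coords (G p) (G q) (push E F G q (Y q)))
      =ᶠ[𝓝 p] fun q => pushCoords G p q (coords p q (Y q)) := by
  filter_upwards [chartDomain_mem_nhds (E := E) p] with q hq
  rw [pushCoords_coords hq]

theorem DifferentiableAlong.push (hG : ContMDiff 𝓘(ℝ, E) 𝓘(ℝ, F) ∞ G)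
    {Y : Π p : L, TangentSpace 𝓘(ℝ, E) p} (hY : MDiffAt (T% Y) p) :
    DifferentiableAlong E G (fun q => push E F G q (Y q)) p :=
  ((mdifferentiableAt_pushCoords hG p).clm_apply
    (mdifferentiableAt_coords hY)).congr_of_eventuallyEq (eventually_coords_push G Y p)

/-- Modulo `range G_*`, the second fundamental form of `G` is symmetric. -/
theorem pullbackConnection_push_sub_mem_rangeAt [FiniteDimensional ℝ F]
    [RiemannianBundle (fun x : K => TangentSpace 𝓘(ℝ, F) x)]
    [IsContMDiffRiemannianBundle 𝓘(ℝ, F) ∞ F (fun x : K => TangentSpace 𝓘(ℝ, F) x)]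
    (hG : ContMDiff 𝓘(ℝ, E) 𝓘(ℝ, F) ∞ G) {Y Z : Π p : L, TangentSpace 𝓘(ℝ, E) p}
    (hY : MDiffAt (T% Y) p) (hZ : MDiffAt (T% Z) p) :
    pullbackConnection E F G (fun q => SlantMaps.push E F G q (Z q)) p (Y p)
      - pullbackConnection E F G (fun q => SlantMaps.push E F G q (Y q)) p (Z p)
      ∈ rangeAt E F G p := by
  have hT := mdifferentiableAt_pushCoords hG p
  have h : ∀ a : E, ofCoords (G p) (pushCoords G p p a) = SlantMaps.push E F G p (frame p p a) := by
    intro a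
    simp [pushCoords, ofCoords_coords]
  -- The Hessian terms and the Christoffel terms cancel by symmetry. Only `G_*` applied to a
  -- difference of coordinate derivatives of `Z` and `Y` is left.
  rw [pullbackConnection_apply, pullbackConnection_apply,
    mvfderiv_congr (eventually_coords_push G Y p), mvfderiv_congr (eventually_coords_push G Z p),
    mvfderiv_clm_apply hT (mdifferentiableAt_coords hY),
    mvfderiv_clm_apply hT (mdifferentiableAt_coords hZ), mvfderiv_pushCoords_comm hG p (Z p),
    christoffel_comm, map_add, map_add, h, h, add_sub_add_right_eq_sub, add_sub_add_left_eq_sub,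
    ← map_sub]
  exact ⟨_, rfl⟩

end Differential

end FieldsAlong

/-! ### Linear algebra of the slant condition. -/

section LinearAlgebra

variable {T : Type*} [NormedAddCommGroup T] [InnerProductSpace ℝ T] {S : Submodule ℝ T}

theorem inner_starProjection_of_mem [S.HasOrthogonalProjection] (a : T) {n : T} (hn : n ∈ S) :
    ⟪S.starProjection a, n⟫_ℝ = ⟪a, n⟫_ℝ := by
  rw [Submodule.inner_starProjection_left_eq_right, Submodule.starProjection_eq_self_iff.2 hn]

/-- If the tangential part `ρ` of an isometric complex structure scales the norm of every vector of
`S` by the same factor, then `ρ² = -c`. -/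
theorem starProjection_starProjection_eq_neg_smul [S.HasOrthogonalProjection] (J : T →ₗ[ℝ] T)
    (hsq : ∀ v, J (J v) = -v) (hJ : ∀ v w, ⟪J v, J w⟫_ℝ = ⟪v, w⟫_ℝ) {c : ℝ}
    (hc : ∀ v ∈ S, ‖S.starProjection (J v)‖ ^ 2 = c * ‖v‖ ^ 2) {v : T} (hv : v ∈ S) :
    S.starProjection (J (S.starProjection (J v))) = (-c) • v := by
  have hskew : ∀ v w, ⟪J v, w⟫_ℝ = - ⟪v, J w⟫_ℝ := by
    intro v w
    rw [← hJ (J v) w, hsq, inner_neg_left]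
  have hmem : ∀ a, S.starProjection a ∈ S := fun a => Submodule.starProjection_apply_mem S a
  -- Polarisation of the norm hypothesis.
  have hpol : ∀ v ∈ S, ∀ w ∈ S,
      ⟪S.starProjection (J v), S.starProjection (J w)⟫_ℝ = c * ⟪v, w⟫_ℝ := by
    intro v hv w hw
    have h1 := hc _ (S.add_mem hv hw)
    have h2 := hc _ hv
    have h3 := hc _ hw
    rw [map_add, map_add, norm_add_sq_real, norm_add_sq_real] at h1
    linarith
  -- As `J` is skew, `⟪πJπJv, w⟫ = -⟪πJv, πJw⟫ = -c⟪v, w⟫` for `w` in `S`, with `π` the projection.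
  -- The vector tested lies in `S`, so it may be paired with itself.
  have key : ∀ w ∈ S, ⟪S.starProjection (J (S.starProjection (J v))) + c • v, w⟫_ℝ = 0 := by
    intro w hw
    rw [inner_add_left, inner_starProjection_of_mem _ hw, hskew, inner_smul_left]
    rw [real_inner_comm, ← inner_starProjection_of_mem (J w) (hmem (J v)), real_inner_comm,
      hpol v hv w hw]
    simp
  have h := key (S.starProjection (J (S.starProjection (J v))) + c • v)
    (S.add_mem (hmem _) (S.smul_mem c hv))
  rw [inner_self_eq_zero] at h
  rw [neg_smul]
  exact eq_neg_of_add_eq_zero_left h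

theorem norm_starProjection_sq_eq_of_angle [S.HasOrthogonalProjection] {a : T} {θ : ℝ}
    (h : InnerProductGeometry.angle a (S.starProjection a) = θ) :
    ‖S.starProjection a‖ ^ 2 = Real.cos θ ^ 2 * ‖a‖ ^ 2 := by
  have h1 := InnerProductGeometry.cos_angle_mul_norm_mul_norm a (S.starProjection a)
  rw [← inner_starProjection_of_mem a (Submodule.starProjection_apply_mem S a),
    real_inner_self_eq_norm_sq, h] at h1
  rcases eq_or_ne (S.starProjection a) 0 with h0 | h0
  -- The convention that an angle with the zero vector is `π / 2` makes the cosine vanish, as the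
  -- formula requires.
  · rw [h0, InnerProductGeometry.angle_zero_right] at h
    rw [h0, ← h, Real.cos_pi_div_two]
    simp
  · have h2 : Real.cos θ * ‖a‖ = ‖S.starProjection a‖ := by
      apply mul_right_cancel₀ (norm_ne_zero_iff.2 h0)
      linarith
    rw [← h2]
    ring

end LinearAlgebra

/-! ### Adjoints of linear maps that are conformal on the complement of the kernel. -/

section ConformalLinearMap

variable {T₁ T₂ : Type*} [NormedAddCommGroup T₁] [InnerProductSpace ℝ T₁] [FiniteDimensional ℝ T₁]
  [NormedAddCommGroup T₂] [InnerProductSpace ℝ T₂] [FiniteDimensional ℝ T₂] {A : T₁ →ₗ[ℝ] T₂}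
  {c : ℝ}

theorem adjoint_apply_of_mem_ker_orthogonal
    (hc : ∀ X ∈ (LinearMap.ker A)ᗮ, ∀ Y ∈ (LinearMap.ker A)ᗮ, ⟪A X, A Y⟫_ℝ = c * ⟪X, Y⟫_ℝ)
    {x : T₁} (hx : x ∈ (LinearMap.ker A)ᗮ) : LinearMap.adjoint A (A x) = c • x := by
  refine ext_inner_right ℝ fun w => ?_
  obtain ⟨k, hk, h, hh, rfl⟩ := (LinearMap.ker A).exists_add_mem_mem_orthogonal w
  rw [LinearMap.adjoint_inner_left, map_add, LinearMap.mem_ker.1 hk, zero_add, hc x hx h hh,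
    inner_smul_left, inner_add_right, Submodule.inner_left_of_mem_orthogonal hk hx, zero_add]
  rfl

/-- On the range, `A A*` is `c` because `A* A` is `c` on horizontal vectors; off it, `A*` kills the
complement of the range. This expresses the projection to the range through `A` and its adjoint,
with no choice of a frame of the range. -/
theorem apply_adjoint_eq_smul_starProjection
    (hc : ∀ X ∈ (LinearMap.ker A)ᗮ, ∀ Y ∈ (LinearMap.ker A)ᗮ, ⟪A X, A Y⟫_ℝ = c * ⟪X, Y⟫_ℝ)
    (v : T₂) : A (LinearMap.adjoint A v) = c • (LinearMap.range A).starProjection v := by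
  obtain ⟨a, ⟨x, rfl⟩, n, hn, rfl⟩ := (LinearMap.range A).exists_add_mem_mem_orthogonal v
  obtain ⟨k, hk, h, hh, rfl⟩ := (LinearMap.ker A).exists_add_mem_mem_orthogonal x
  have hn0 : LinearMap.adjoint A n = 0 := by
    refine ext_inner_right ℝ fun w => ?_
    rw [LinearMap.adjoint_inner_left, inner_zero_left,
      Submodule.inner_left_of_mem_orthogonal (LinearMap.mem_range_self A w) hn]
  rw [map_add A, LinearMap.mem_ker.1 hk, zero_add, map_add, hn0, add_zero,
    adjoint_apply_of_mem_ker_orthogonal hc hh, map_smul, map_add,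
    Submodule.starProjection_eq_self_iff.2 (LinearMap.mem_range_self A h),
    (Submodule.starProjection_apply_eq_zero_iff _).2 hn, add_zero]

end ConformalLinearMap

/-! ### Differentiability of the adjoint of the differential. -/

section Adjoint

variable {E : Type*} [NormedAddCommGroup E] [NormedSpace ℝ E] [FiniteDimensional ℝ E]
  {L : Type*} [TopologicalSpace L] [ChartedSpace E L] [IsManifold 𝓘(ℝ, E) ∞ L]
  [RiemannianBundle (fun x : L => TangentSpace 𝓘(ℝ, E) x)]
  {F : Type*} [NormedAddCommGroup F] [NormedSpace ℝ F] [FiniteDimensional ℝ F]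
  {K : Type*} [TopologicalSpace K] [ChartedSpace F K] [IsManifold 𝓘(ℝ, F) ∞ K]
  [RiemannianBundle (fun x : K => TangentSpace 𝓘(ℝ, F) x)]
  {G : L → K} {V : Π p : L, TangentSpace 𝓘(ℝ, F) (G p)} {p : L}

omit [IsManifold 𝓘(ℝ, E) ∞ L] [IsManifold 𝓘(ℝ, F) ∞ K] in
theorem inner_pushAdjoint (v : TangentSpace 𝓘(ℝ, F) (G p)) (x : TangentSpace 𝓘(ℝ, E) p) :
    ⟪pushAdjoint E F G p v, x⟫_ℝ = ⟪v, push E F G p x⟫_ℝ :=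
  LinearMap.adjoint_inner_left (push E F G p).toLinearMap x v

omit [FiniteDimensional ℝ E] in
theorem gram_injective {q : L} (hq : q ∈ chartDomain E p) :
    Function.Injective (gram (E := E) p q) := by
  rw [injective_iff_map_eq_zero]
  intro a ha
  have h : gram p q a a = 0 := by rw [ha]; rfl
  rw [gram_apply, inner_self_eq_zero] at h
  rw [← coords_frame hq a, h, map_zero]

theorem finrank_dual_eq : Module.finrank ℝ E = Module.finrank ℝ (E →L[ℝ] ℝ) := by
  rw [← (LinearMap.toContinuousLinearMap (𝕜 := ℝ) (E := E) (F' := ℝ)).finrank_eq]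
  exact (Subspace.dual_finrank_eq (K := ℝ) (V := E)).symm

/-- The Gram form as an isomorphism to the dual space. -/
def gramEquiv {q : L} (hq : q ∈ chartDomain E p) : E ≃L[ℝ] (E →L[ℝ] ℝ) :=
  (LinearMap.linearEquivOfInjective (gram (E := E) p q).toLinearMap (gram_injective hq)
    finrank_dual_eq).toContinuousLinearEquiv

theorem coe_gramEquiv {q : L} (hq : q ∈ chartDomain E p) :
    (gramEquiv hq : E →L[ℝ] E →L[ℝ] ℝ) = gram p q := by
  ext a b
  rfl

/-- The defining equation of the adjoint in coordinates, a linear system for `*G_* v` with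
invertible matrix the Gram form of `L`. -/
theorem gram_coords_pushAdjoint {q : L} (hq : q ∈ chartDomain E p)
    (hGq : G q ∈ chartDomain F (G p)) (v : TangentSpace 𝓘(ℝ, F) (G q)) :
    gram p q (coords p q (pushAdjoint E F G q v))
      = (gram (G p) (G q) (coords (G p) (G q) v)) ∘L pushCoords G p q := by
  ext b
  have h : coords (G p) (G q) (push E F G q (frame p q b)) = pushCoords G p q b := rfl
  rw [gram_apply, frame_coords hq, inner_pushAdjoint, ContinuousLinearMap.comp_apply, ← h,
    gram_coords hGq]

variable [IsContMDiffRiemannianBundle 𝓘(ℝ, E) ∞ E (fun x : L => TangentSpace 𝓘(ℝ, E) x)]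
  [IsContMDiffRiemannianBundle 𝓘(ℝ, F) ∞ F (fun x : K => TangentSpace 𝓘(ℝ, F) x)]

theorem DifferentiableAlong.pushAdjoint (hG : ContMDiff 𝓘(ℝ, E) 𝓘(ℝ, F) ∞ G)
    (hV : DifferentiableAlong E G V p) : MDiffAt (T% (fun q => pushAdjoint E F G q (V q))) p := by
  rw [mdifferentiableAt_section_iff_coords]
  have hGp : MDifferentiableAt 𝓘(ℝ, E) 𝓘(ℝ, F) G p := (hG p).mdifferentiableAt (by simp)
  have hg : MDifferentiableAt 𝓘(ℝ, E) 𝓘(ℝ, F →L[ℝ] F →L[ℝ] ℝ) (fun q => gram (G p) (G q)) p :=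
    MDifferentiableAt.comp (g := gram (G p)) p (mdifferentiableAt_gram (E := F) (G p)) hGp
  -- Inversion of operators is smooth at an invertible one, so the system can be solved
  -- differentiably in `q`.
  have hinv : MDifferentiableAt 𝓘(ℝ, E) 𝓘(ℝ, (E →L[ℝ] ℝ) →L[ℝ] E)
      (fun q => (gram (E := E) p q).inverse) p := by
    have h := contDiffAt_map_inverse (𝕜 := ℝ) (n := 1) (gramEquiv (mem_chartDomain (E := E) p))
    rw [coe_gramEquiv] at h
    exact (h.differentiableAt (by simp)).comp_mdifferentiableAt (mdifferentiableAt_gram (E := E) p)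
  refine (hinv.clm_apply ((hg.clm_apply hV).clm_comp
    (mdifferentiableAt_pushCoords hG p))).congr_of_eventuallyEq ?_
  filter_upwards [chartDomain_mem_nhds (E := E) p,
    eventually_mem_chartDomain (F := F) hG.continuous.continuousAt] with q hq hGq
  rw [← gram_coords_pushAdjoint hq hGq, ← coe_gramEquiv hq, ContinuousLinearMap.inverse_equiv]
  exact ((gramEquiv hq).symm_apply_apply _).symm

end Adjoint

/-! ### Tangential and normal parts at a point. -/

section Conformal

variable {E : Type*} [NormedAddCommGroup E] [NormedSpace ℝ E] [FiniteDimensional ℝ E]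
  {L : Type*} [TopologicalSpace L] [ChartedSpace E L]
  [RiemannianBundle (fun x : L => TangentSpace 𝓘(ℝ, E) x)]
  {F : Type*} [NormedAddCommGroup F] [NormedSpace ℝ F] [FiniteDimensional ℝ F]
  {K : Type*} [TopologicalSpace K] [ChartedSpace F K]
  [RiemannianBundle (fun x : K => TangentSpace 𝓘(ℝ, F) x)]
  {G : L → K} {p : L} {c : ℝ}

theorem push_mem_rangeAt (x : TangentSpace 𝓘(ℝ, E) p) : push E F G p x ∈ rangeAt E F G p :=
  ⟨x, rfl⟩

theorem push_pushAdjoint_of_mem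
    (hc : ∀ X ∈ horizontal E F G p, ∀ Y ∈ horizontal E F G p,
      ⟪push E F G p X, push E F G p Y⟫_ℝ = c * ⟪X, Y⟫_ℝ)
    {x : TangentSpace 𝓘(ℝ, E) p} (hx : x ∈ horizontal E F G p) :
    pushAdjoint E F G p (push E F G p x) = c • x :=
  adjoint_apply_of_mem_ker_orthogonal (A := (push E F G p).toLinearMap) hc hx

theorem push_pushAdjoint
    (hc : ∀ X ∈ horizontal E F G p, ∀ Y ∈ horizontal E F G p,
      ⟪push E F G p X, push E F G p Y⟫_ℝ = c * ⟪X, Y⟫_ℝ) (v : TangentSpace 𝓘(ℝ, F) (G p)) :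
    push E F G p (pushAdjoint E F G p v) = c • (rangeAt E F G p).starProjection v :=
  apply_adjoint_eq_smul_starProjection (A := (push E F G p).toLinearMap) hc v

variable {J : Π x : K, TangentSpace 𝓘(ℝ, F) x →L[ℝ] TangentSpace 𝓘(ℝ, F) x}

theorem tangentPart_add_normalPart (v : TangentSpace 𝓘(ℝ, F) (G p)) :
    tangentPart E F G J p v + normalPart E F G J p v = J (G p) v := by
  rw [tangentPart, normalPart, Submodule.starProjection_orthogonal']
  simp

theorem normalPart_eq_sub (v : TangentSpace 𝓘(ℝ, F) (G p)) :
    normalPart E F G J p v = J (G p) v - tangentPart E F G J p v := by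
  rw [← tangentPart_add_normalPart (E := E) v]
  abel

theorem tangentPart_mem (v : TangentSpace 𝓘(ℝ, F) (G p)) :
    tangentPart E F G J p v ∈ rangeAt E F G p :=
  Submodule.starProjection_apply_mem _ _

theorem normalPart_mem (v : TangentSpace 𝓘(ℝ, F) (G p)) :
    normalPart E F G J p v ∈ (rangeAt E F G p)ᗮ :=
  Submodule.starProjection_apply_mem _ _

end Conformal

/-! ### Lifts of fields along the map and integrability of the range. -/

section ConformalMaps

variable {E : Type*} [NormedAddCommGroup E] [NormedSpace ℝ E] [FiniteDimensional ℝ E]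
  {L : Type*} [TopologicalSpace L] [ChartedSpace E L] [IsManifold 𝓘(ℝ, E) ∞ L]
  [RiemannianBundle (fun x : L => TangentSpace 𝓘(ℝ, E) x)]
  [IsContMDiffRiemannianBundle 𝓘(ℝ, E) ∞ E (fun x : L => TangentSpace 𝓘(ℝ, E) x)]
  {F : Type*} [NormedAddCommGroup F] [NormedSpace ℝ F] [FiniteDimensional ℝ F]
  {K : Type*} [TopologicalSpace K] [ChartedSpace F K] [IsManifold 𝓘(ℝ, F) ∞ K]
  [RiemannianBundle (fun x : K => TangentSpace 𝓘(ℝ, F) x)]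
  [IsContMDiffRiemannianBundle 𝓘(ℝ, F) ∞ F (fun x : K => TangentSpace 𝓘(ℝ, F) x)]
  {G : L → K} {V W : Π p : L, TangentSpace 𝓘(ℝ, F) (G p)} {p : L} {l : L → ℝ}

/-- The candidate `l⁻² *G_* V` for the horizontal lift of a field `V` along `G`, where `l` is the
dilation of `G`. -/
def lift (l : L → ℝ) (G : L → K) (V : Π p : L, TangentSpace 𝓘(ℝ, F) (G p)) (p : L) :
    TangentSpace 𝓘(ℝ, E) p :=
  (l p ^ 2)⁻¹ • pushAdjoint E F G p (V p)

theorem mdifferentiableAt_lift (hG : ContMDiff 𝓘(ℝ, E) 𝓘(ℝ, F) ∞ G)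
    (hl : ContMDiff 𝓘(ℝ, E) 𝓘(ℝ) ∞ l) (hpos : ∀ p, 0 < l p)
    (hV : DifferentiableAlong E G V p) : MDiffAt (T% (lift (E := E) l G V)) p := by
  have h1 : DifferentiableAt ℝ (fun t : ℝ => (t ^ 2)⁻¹) (l p) :=
    (differentiableAt_id.pow 2).inv (pow_ne_zero 2 (hpos p).ne')
  have h2 : MDifferentiableAt 𝓘(ℝ, E) 𝓘(ℝ) (fun q => (l q ^ 2)⁻¹) p :=
    h1.comp_mdifferentiableAt (f := l) ((hl p).mdifferentiableAt (by simp))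
  exact MDifferentiableAt.smul_section h2 (hV.pushAdjoint hG)

theorem push_lift (hpos : ∀ p, 0 < l p)
    (hc : ∀ p, ∀ X ∈ horizontal E F G p, ∀ Y ∈ horizontal E F G p,
      ⟪push E F G p X, push E F G p Y⟫_ℝ = l p ^ 2 * ⟪X, Y⟫_ℝ)
    (V : Π p : L, TangentSpace 𝓘(ℝ, F) (G p)) (q : L) :
    push E F G q (lift l G V q) = (rangeAt E F G q).starProjection (V q) := by
  rw [lift, map_smul, push_pushAdjoint (hc q), smul_smul,
    inv_mul_cancel₀ (pow_ne_zero 2 (hpos q).ne'), one_smul]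

/-- The projection is `G_*` after the lift `l⁻² *G_*`, and both preserve differentiability, so no
constant rank argument is needed. -/
theorem IsConformalRiemannianMap.differentiableAlong_starProjection
    (h : IsConformalRiemannianMap E F G) (hV : DifferentiableAlong E G V p) :
    DifferentiableAlong E G (fun q => (rangeAt E F G q).starProjection (V q)) p := by
  obtain ⟨hG, l, hl, hpos, hc⟩ := h
  have h1 := DifferentiableAlong.push hG (mdifferentiableAt_lift hG hl hpos hV)
  simpa only [push_lift hpos hc] using h1

/-- The second fundamental form of `G`, paired with a normal vector, is symmetric. -/
theorem inner_pullbackConnection_push_comm (hG : ContMDiff 𝓘(ℝ, E) 𝓘(ℝ, F) ∞ G)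
    {Y Z : Π p : L, TangentSpace 𝓘(ℝ, E) p} (hY : MDiffAt (T% Y) p) (hZ : MDiffAt (T% Z) p)
    {n : TangentSpace 𝓘(ℝ, F) (G p)} (hn : n ∈ (rangeAt E F G p)ᗮ) :
    ⟪pullbackConnection E F G (fun q => push E F G q (Z q)) p (Y p), n⟫_ℝ
      = ⟪pullbackConnection E F G (fun q => push E F G q (Y q)) p (Z p), n⟫_ℝ := by
  rw [← sub_eq_zero, ← inner_sub_left]
  exact Submodule.inner_right_of_mem_orthogonal
    (pullbackConnection_push_sub_mem_rangeAt hG hY hZ) hn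

/-- The image of the differential of a conformal Riemannian map is involutive. -/
theorem IsConformalRiemannianMap.rangeIntegrable (h : IsConformalRiemannianMap E F G) :
    RangeIntegrable E F G := by
  obtain ⟨hG, l, hl, hpos, hc⟩ := h
  intro U V hU hV hGUV A B hA hB hAr hBr p hp
  have hGp : MDifferentiableAt 𝓘(ℝ, E) 𝓘(ℝ, F) G p := (hG p).mdifferentiableAt (by simp)
  have hVp : V ∈ 𝓝 (G p) := hV.mem_nhds (hGUV hp)
  have hA' : MDiffAt (T% A) (G p) := (hA.contMDiffAt hVp).mdifferentiableAt (by simp)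
  have hB' : MDiffAt (T% B) (G p) := (hB.contMDiffAt hVp).mdifferentiableAt (by simp)
  have hlift : ∀ A : Π x : K, TangentSpace 𝓘(ℝ, F) x, (∀ p ∈ U, A (G p) ∈ rangeAt E F G p) →
      ∀ q ∈ U, push E F G q (lift l G (fun q => A (G q)) q) = A (G q) := by
    intro A hAr q hq
    rw [push_lift hpos hc, Submodule.starProjection_eq_self_iff.2 (hAr q hq)]
  have hWA : MDiffAt (T% (lift (E := E) l G fun q => A (G q))) p :=
    mdifferentiableAt_lift hG hl hpos (DifferentiableAlong.comp hGp hA')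
  have hWB : MDiffAt (T% (lift (E := E) l G fun q => B (G q))) p :=
    mdifferentiableAt_lift hG hl hpos (DifferentiableAlong.comp hGp hB')
  have hmem := pullbackConnection_push_sub_mem_rangeAt hG hWA hWB
  have hcongr : ∀ A : Π x : K, TangentSpace 𝓘(ℝ, F) x, (∀ p ∈ U, A (G p) ∈ rangeAt E F G p) →
      ∀ᶠ q in 𝓝 p, push E F G q (lift l G (fun q => A (G q)) q) = A (G q) := fun A hAr =>
    Filter.mem_of_superset (hU.mem_nhds hp) (hlift A hAr)
  -- Near `p` the pushed lifts are `A ∘ G` and `B ∘ G`, so the element of the range becomes `∇_A B -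
  -- ∇_B A = [A, B]` at `G p`.
  rw [pullbackConnection_congr (hcongr A hAr), pullbackConnection_congr (hcongr B hBr),
    pullbackConnection_comp hGp hA', pullbackConnection_comp hGp hB', hlift A hAr p hp,
    hlift B hBr p hp, leviCivita_sub_eq_mlieBracket hA' hB'] at hmem
  exact hmem

end ConformalMaps

/-! ### Slant maps into Kähler manifolds: equivalence of the two identities. -/

section SlantMaps

variable {E : Type*} [NormedAddCommGroup E] [NormedSpace ℝ E] [FiniteDimensional ℝ E]
  {L : Type*} [TopologicalSpace L] [ChartedSpace E L] [IsManifold 𝓘(ℝ, E) ∞ L]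
  [RiemannianBundle (fun x : L => TangentSpace 𝓘(ℝ, E) x)]
  {F : Type*} [NormedAddCommGroup F] [NormedSpace ℝ F] [FiniteDimensional ℝ F]
  {K : Type*} [TopologicalSpace K] [ChartedSpace F K] [IsManifold 𝓘(ℝ, F) ∞ K]
  [RiemannianBundle (fun x : K => TangentSpace 𝓘(ℝ, F) x)]
  {J : Π x : K, TangentSpace 𝓘(ℝ, F) x →L[ℝ] TangentSpace 𝓘(ℝ, F) x}
  {G : L → K} {p : L}

theorem IsKahler.inner_left (hJ : IsKahler (E := F) J) (x : K) (v w : TangentSpace 𝓘(ℝ, F) x) :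
    ⟪J x v, w⟫_ℝ = - ⟪v, J x w⟫_ℝ := by
  rw [← hJ.hermitian x (J x v) w, hJ.sq_eq_neg, inner_neg_left]

/-- The constant is `cos² Θ(p)`: by the slant condition `ρ` scales all norms on the range by `|cos
Θ(p)|`. -/
theorem IsCPSRM.exists_tangentPart_tangentPart (hJ : IsKahler (E := F) J) (hG : IsCPSRM E F G J)
    (p : L) : ∃ c : ℝ, ∀ v ∈ rangeAt E F G p,
      tangentPart E F G J p (tangentPart E F G J p v) = (-c) • v := by
  obtain ⟨-, Θ, hΘ⟩ := hG
  refine ⟨Real.cos (Θ p) ^ 2, fun v hv => ?_⟩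
  refine starProjection_starProjection_eq_neg_smul (S := rangeAt E F G p) (J (G p)).toLinearMap
    (hJ.sq_eq_neg (G p)) (hJ.hermitian (G p)) (fun v hv => ?_) hv
  have hnorm : ‖J (G p) v‖ ^ 2 = ‖v‖ ^ 2 := by
    rw [← real_inner_self_eq_norm_sq, ← real_inner_self_eq_norm_sq, hJ.hermitian]
  rw [← hnorm]
  rcases eq_or_ne v 0 with rfl | h0
  · simp
  · exact norm_starProjection_sq_eq_of_angle (hΘ p v hv h0)

variable [IsContMDiffRiemannianBundle 𝓘(ℝ, E) ∞ E (fun x : L => TangentSpace 𝓘(ℝ, E) x)]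
  [IsContMDiffRiemannianBundle 𝓘(ℝ, F) ∞ F (fun x : K => TangentSpace 𝓘(ℝ, F) x)]
  {V : Π p : L, TangentSpace 𝓘(ℝ, F) (G p)}

theorem DifferentiableAlong.tangentPart (hJ : IsKahler (E := F) J)
    (hG : IsConformalRiemannianMap E F G) (hV : DifferentiableAlong E G V p) :
    DifferentiableAlong E G (fun q => tangentPart E F G J q (V q)) p :=
  hG.differentiableAlong_starProjection
    (hV.endomorphism hJ.smooth ((hG.1 p).mdifferentiableAt (by simp)))

theorem DifferentiableAlong.normalPart (hJ : IsKahler (E := F) J)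
    (hG : IsConformalRiemannianMap E F G) (hV : DifferentiableAlong E G V p) :
    DifferentiableAlong E G (fun q => normalPart E F G J q (V q)) p := by
  simp only [normalPart_eq_sub]
  exact (hV.endomorphism hJ.smooth ((hG.1 p).mdifferentiableAt (by simp))).sub
    (hV.tangentPart hJ hG)

theorem inner_normalConnection (X : Π p : L, TangentSpace 𝓘(ℝ, E) p) (p : L)
    {n : TangentSpace 𝓘(ℝ, F) (G p)} (hn : n ∈ (rangeAt E F G p)ᗮ) :
    ⟪normalConnection E F G X V p, n⟫_ℝ = ⟪pullbackConnection E F G V p (X p), n⟫_ℝ :=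
  inner_starProjection_of_mem _ hn

theorem inner_secondFundamentalFormPerp (X Y : Π p : L, TangentSpace 𝓘(ℝ, E) p) (p : L)
    {n : TangentSpace 𝓘(ℝ, F) (G p)} (hn : n ∈ (rangeAt E F G p)ᗮ) :
    ⟪secondFundamentalFormPerp E F G X Y p, n⟫_ℝ
      = ⟪pullbackConnection E F G (fun q => push E F G q (Y q)) p (X p), n⟫_ℝ := by
  rw [secondFundamentalFormPerp, inner_starProjection_of_mem _ hn, secondFundamentalForm,
    inner_sub_left, Submodule.inner_right_of_mem_orthogonal (push_mem_rangeAt _) hn, sub_zero]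

/-- `g((∇G_*)^⊥(Y, *G_*W), n) = l² g(∇^G_Y W, n)` for a field `W` tangent to `range G_*`. -/
theorem inner_secondFundamentalFormPerp_pushAdjoint {l : L → ℝ}
    (hl : MDifferentiableAt 𝓘(ℝ, E) 𝓘(ℝ) l p)
    (hc : ∀ p, ∀ X ∈ horizontal E F G p, ∀ Y ∈ horizontal E F G p,
      ⟪push E F G p X, push E F G p Y⟫_ℝ = l p ^ 2 * ⟪X, Y⟫_ℝ)
    (hV : DifferentiableAlong E G V p) (hVr : ∀ q, V q ∈ rangeAt E F G q)
    (Y : Π p : L, TangentSpace 𝓘(ℝ, E) p)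
    {n : TangentSpace 𝓘(ℝ, F) (G p)} (hn : n ∈ (rangeAt E F G p)ᗮ) :
    ⟪secondFundamentalFormPerp E F G Y (fun q => pushAdjoint E F G q (V q)) p, n⟫_ℝ
      = l p ^ 2 * ⟪pullbackConnection E F G V p (Y p), n⟫_ℝ := by
  have h : (fun q => push E F G q (pushAdjoint E F G q (V q))) = fun q => (l q ^ 2) • V q := by
    funext q
    rw [push_pushAdjoint (hc q), Submodule.starProjection_eq_self_iff.2 (hVr q)]
  have hl2 : MDifferentiableAt 𝓘(ℝ, E) 𝓘(ℝ) (fun q => l q ^ 2) p :=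
    ((differentiableAt_id (𝕜 := ℝ) (E := ℝ)).pow 2).comp_mdifferentiableAt (f := l) hl
  -- The derivative of `l²` multiplies a tangent vector, which is orthogonal to `n`.
  rw [inner_secondFundamentalFormPerp _ _ _ hn, h, pullbackConnection_smul hl2 hV, inner_add_left,
    inner_smul_left, inner_smul_left, Submodule.inner_right_of_mem_orthogonal (hVr p) hn]
  simp

/-- Differentiating `ρ² = -cos² Θ` would require a differentiable `cos² Θ`. Instead `ρρG_*Z` is
written as `G_*W`, and the symmetry of the second fundamental form moves the derivative to `G_*Y`;
then only the value `W(p) = -c Z(p)` matters. -/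
theorem inner_pullbackConnection_tangentPart_tangentPart (hJ : IsKahler (E := F) J)
    (hG : IsCPSRM E F G J) {c : ℝ} (hc : ∀ v ∈ rangeAt E F G p,
      tangentPart E F G J p (tangentPart E F G J p v) = (-c) • v)
    {Y Z : Π p : L, TangentSpace 𝓘(ℝ, E) p} (hY : MDiffAt (T% Y) p) (hZ : MDiffAt (T% Z) p)
    (hZh : ∀ p, Z p ∈ horizontal E F G p)
    {n : TangentSpace 𝓘(ℝ, F) (G p)} (hn : n ∈ (rangeAt E F G p)ᗮ) :
    ⟪pullbackConnection E F G
        (fun q => tangentPart E F G J q (tangentPart E F G J q (push E F G q (Z q)))) p (Y p), n⟫_ℝ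
      = -c * ⟪pullbackConnection E F G (fun q => push E F G q (Y q)) p (Z p), n⟫_ℝ := by
  obtain ⟨hsm, l, hl, hpos, hconf⟩ := hG.1
  set V : Π p : L, TangentSpace 𝓘(ℝ, F) (G p) :=
    fun q => tangentPart E F G J q (tangentPart E F G J q (push E F G q (Z q))) with hVdef
  have hV : DifferentiableAlong E G V p :=
    ((DifferentiableAlong.push hsm hZ).tangentPart hJ hG.1).tangentPart hJ hG.1
  have hW : MDiffAt (T% (lift (E := E) l G V)) p := mdifferentiableAt_lift hsm hl hpos hV
  have hVW : V = fun q => push E F G q (lift l G V q) := by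
    funext q
    rw [push_lift hpos hconf, Submodule.starProjection_eq_self_iff.2 (tangentPart_mem _)]
  have hWp : lift l G V p = (-c) • Z p := by
    have hVp : V p = push E F G p ((-c) • Z p) := by
      rw [map_smul]
      exact hc _ (push_mem_rangeAt _)
    rw [lift, hVp, push_pushAdjoint_of_mem (hconf p) (Submodule.smul_mem _ _ (hZh p)), smul_smul,
      inv_mul_cancel₀ (pow_ne_zero 2 (hpos p).ne'), one_smul]
  rw [hVW, inner_pullbackConnection_push_comm hsm hY hW hn, hWp, map_smul, inner_smul_left]
  simp

/-- The computation of `g(∇^G_Y G_*Z, P)` on which the theorem rests. -/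
theorem inner_pullbackConnection_push (hJ : IsKahler (E := F) J) (hG : IsCPSRM E F G J)
    {l : L → ℝ} (hl : ContMDiff 𝓘(ℝ, E) 𝓘(ℝ) ∞ l)
    (hconf : ∀ p, ∀ X ∈ horizontal E F G p, ∀ Y ∈ horizontal E F G p,
      ⟪push E F G p X, push E F G p Y⟫_ℝ = l p ^ 2 * ⟪X, Y⟫_ℝ) {c : ℝ}
    (hc : ∀ v ∈ rangeAt E F G p, tangentPart E F G J p (tangentPart E F G J p v) = (-c) • v)
    {Y Z : Π p : L, TangentSpace 𝓘(ℝ, E) p} (hY : MDiffAt (T% Y) p) (hZ : MDiffAt (T% Z) p)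
    (hZh : ∀ p, Z p ∈ horizontal E F G p)
    {P : Π p : L, TangentSpace 𝓘(ℝ, F) (G p)} (hP : DifferentiableAlong E G P p)
    (hPn : ∀ q, P q ∈ (rangeAt E F G q)ᗮ) :
    l p ^ 2 * (⟪pullbackConnection E F G (fun q => push E F G q (Z q)) p (Y p), P p⟫_ℝ
        - c * ⟪pullbackConnection E F G (fun q => push E F G q (Y q)) p (Z p), P p⟫_ℝ
        + ⟪normalConnection E F G Y (fun q =>
            normalPart E F G J q (tangentPart E F G J q (push E F G q (Z q)))) p, P p⟫_ℝ
        - ⟪normalConnection E F G Y (fun q => normalPart E F G J q (push E F G q (Z q))) p,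
            normalPart E F G J p (P p)⟫_ℝ)
      = - ⟪secondFundamentalFormPerp E F G Y
            (fun q => pushAdjoint E F G q (tangentPart E F G J q (P q))) p,
          normalPart E F G J p (push E F G p (Z p))⟫_ℝ := by
  have hGp : MDifferentiableAt 𝓘(ℝ, E) 𝓘(ℝ, F) G p := (hG.1.1 p).mdifferentiableAt (by simp)
  have hZd : DifferentiableAlong E G (fun q => push E F G q (Z q)) p :=
    DifferentiableAlong.push hG.1.1 hZ
  have hρ := hZd.tangentPart hJ hG.1
  have hϖ := hZd.normalPart hJ hG.1
  have hρρ := hρ.tangentPart hJ hG.1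
  have hϖρ := hρ.normalPart hJ hG.1
  have hDP := hP.tangentPart hJ hG.1
  -- `J` is parallel, so it passes under the derivative and splits there into its two parts.
  have split : ∀ {V : Π p : L, TangentSpace 𝓘(ℝ, F) (G p)}, DifferentiableAlong E G V p →
      J (G p) (pullbackConnection E F G V p (Y p))
        = pullbackConnection E F G (fun q => tangentPart E F G J q (V q)) p (Y p)
          + pullbackConnection E F G (fun q => normalPart E F G J q (V q)) p (Y p) := by
    intro V hV
    rw [← hJ.pullbackConnection hGp hV, ← pullbackConnection_add (hV.tangentPart hJ hG.1)
      (hV.normalPart hJ hG.1)]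
    simp only [tangentPart_add_normalPart]
  have e1 := inner_pullbackConnection_tangentPart_tangentPart hJ hG hc hY hZ hZh (hPn p)
  -- `ϖG_*Z` and `𝒟P` are everywhere orthogonal, so the derivative moves onto `𝒟P`, where `e3`
  -- recognises the second fundamental form.
  have e2 := inner_pullbackConnection_of_inner_eq_zero hGp hϖ hDP (fun q =>
    Submodule.inner_left_of_mem_orthogonal (tangentPart_mem _) (normalPart_mem _)) (Y p)
  have e3 := inner_secondFundamentalFormPerp_pushAdjoint ((hl p).mdifferentiableAt (by simp)) hconf
    hDP (fun q => tangentPart_mem _) Y (normalPart_mem (J := J) (push E F G p (Z p)))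
  have a1 : ⟪pullbackConnection E F G (fun q => push E F G q (Z q)) p (Y p), P p⟫_ℝ
      = ⟪pullbackConnection E F G (fun q => tangentPart E F G J q (push E F G q (Z q))) p (Y p),
          J (G p) (P p)⟫_ℝ
        + ⟪pullbackConnection E F G (fun q => normalPart E F G J q (push E F G q (Z q))) p (Y p),
          J (G p) (P p)⟫_ℝ := by
    rw [← hJ.hermitian, split hZd, inner_add_left]
  -- Moving `J` from `P` back to the derivative applies it a second time, producing the `ρρ` and
  -- `ϖρ` terms.
  have a2 := hJ.inner_left (G p)
    (pullbackConnection E F G (fun q => tangentPart E F G J q (push E F G q (Z q))) p (Y p)) (P p)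
  rw [split hρ, inner_add_left, e1] at a2
  have a3 : ⟪pullbackConnection E F G (fun q => normalPart E F G J q (push E F G q (Z q))) p (Y p),
        J (G p) (P p)⟫_ℝ
      = ⟪pullbackConnection E F G (fun q => normalPart E F G J q (push E F G q (Z q))) p (Y p),
          tangentPart E F G J p (P p)⟫_ℝ
        + ⟪pullbackConnection E F G (fun q => normalPart E F G J q (push E F G q (Z q))) p (Y p),
          normalPart E F G J p (P p)⟫_ℝ := by
    rw [← inner_add_right, tangentPart_add_normalPart]
  rw [real_inner_comm] at e3
  rw [inner_normalConnection Y p (hPn p), inner_normalConnection Y p (normalPart_mem _),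
    real_inner_comm (normalPart E F G J p (push E F G p (Z p))), e3, a1, a3, e2,
    real_inner_comm (normalPart E F G J p (push E F G p (Z p)))]
  linear_combination l p ^ 2 * a2

/-- The normal connection identity holds at a point if and only if the second fundamental form
identity does. -/
theorem normalConnection_identity_iff (hJ : IsKahler (E := F) J) (hG : IsCPSRM E F G J)
    {Y Z : Π p : L, TangentSpace 𝓘(ℝ, E) p} {P : Π p : L, TangentSpace 𝓘(ℝ, F) (G p)}
    (hY : IsHorizontalField E F G Y) (hZ : IsHorizontalField E F G Z) (hP : IsNormalField E F G P)
    (p : L) :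
    ⟪normalConnection E F G Z (fun q =>
            normalPart E F G J q (tangentPart E F G J q (push E F G q (Y q)))) p
          - normalConnection E F G Y (fun q =>
            normalPart E F G J q (tangentPart E F G J q (push E F G q (Z q)))) p, P p⟫_ℝ
        = ⟪normalConnection E F G Z (fun q => normalPart E F G J q (push E F G q (Y q))) p
          - normalConnection E F G Y (fun q => normalPart E F G J q (push E F G q (Z q))) p,
          normalPart E F G J p (P p)⟫_ℝ
      ↔ ⟪secondFundamentalFormPerp E F G Y
            (fun q => pushAdjoint E F G q (tangentPart E F G J q (P q))) p,
          normalPart E F G J p (push E F G p (Z p))⟫_ℝ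
        = ⟪secondFundamentalFormPerp E F G Z
            (fun q => pushAdjoint E F G q (tangentPart E F G J q (P q))) p,
          normalPart E F G J p (push E F G p (Y p))⟫_ℝ := by
  obtain ⟨hsm, l, hl, hpos, hconf⟩ := hG.1
  obtain ⟨c, hc⟩ := hG.exists_tangentPart_tangentPart hJ p
  have hYd : MDiffAt (T% Y) p := (hY.1 p).mdifferentiableAt (by simp)
  have hZd : MDiffAt (T% Z) p := (hZ.1 p).mdifferentiableAt (by simp)
  have hPd : DifferentiableAlong E G P p := DifferentiableAlong.of_mdifferentiableAt
    hsm.continuous.continuousAt ((hP.1 p).mdifferentiableAt (by simp))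
  have h1 := inner_pullbackConnection_push hJ hG hl hconf hc hYd hZd hZ.2 hPd hP.2
  have h2 := inner_pullbackConnection_push hJ hG hl hconf hc hZd hYd hY.2 hPd hP.2
  -- After these rewrites both identities contain the same multiple, by `1 - c`, of `g(∇^G_Z G_*Y,
  -- P)`, which drops out of their difference.
  rw [inner_pullbackConnection_push_comm hsm hYd hZd (hP.2 p)] at h1
  rw [inner_pullbackConnection_push_comm hsm hYd hZd (hP.2 p)] at h2
  rw [inner_sub_left, inner_sub_left]
  have hl2 : l p ^ 2 ≠ 0 := pow_ne_zero 2 (hpos p).ne'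
  constructor
  · intro h
    linear_combination h1 - h2 + l p ^ 2 * h
  · intro h
    apply mul_left_cancel₀ hl2
    linear_combination h2 - h1 + h

end SlantMaps

end SlantMaps

end

/-! ### The theorem. -/

theorem theorem4p1
    {E : Type*} [NormedAddCommGroup E] [NormedSpace ℝ E] [FiniteDimensional ℝ E]
    {L : Type*} [TopologicalSpace L] [T2Space L] [SecondCountableTopology L]
    [ChartedSpace E L] [IsManifold 𝓘(ℝ, E) ∞ L]
    [RiemannianBundle (fun x : L => TangentSpace 𝓘(ℝ, E) x)]
    [IsContMDiffRiemannianBundle 𝓘(ℝ, E) ∞ E (fun x : L => TangentSpace 𝓘(ℝ, E) x)]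
    {F : Type*} [NormedAddCommGroup F] [NormedSpace ℝ F] [FiniteDimensional ℝ F]
    {K : Type*} [TopologicalSpace K] [T2Space K] [SecondCountableTopology K]
    [ChartedSpace F K] [IsManifold 𝓘(ℝ, F) ∞ K]
    [RiemannianBundle (fun x : K => TangentSpace 𝓘(ℝ, F) x)]
    [IsContMDiffRiemannianBundle 𝓘(ℝ, F) ∞ F (fun x : K => TangentSpace 𝓘(ℝ, F) x)]
    (J : Π x : K, TangentSpace 𝓘(ℝ, F) x →L[ℝ] TangentSpace 𝓘(ℝ, F) x)
    (hJ : SlantMaps.IsKahler (E := F) J)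
    (G : L → K) (hG : SlantMaps.IsCPSRM E F G J) :
    (SlantMaps.RangeIntegrable E F G → SlantMaps.NormalConnectionIdentity E F G J →
      SlantMaps.NormalSecondFundamentalFormSymmetric E F G J) ∧
    (SlantMaps.RangeIntegrable E F G → SlantMaps.NormalSecondFundamentalFormSymmetric E F G J →
      SlantMaps.NormalConnectionIdentity E F G J) ∧
    (SlantMaps.NormalConnectionIdentity E F G J → SlantMaps.NormalSecondFundamentalFormSymmetric E F G J →
      SlantMaps.RangeIntegrable E F G) := by
  have hiff : SlantMaps.NormalConnectionIdentity E F G J ↔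
      SlantMaps.NormalSecondFundamentalFormSymmetric E F G J :=
    ⟨fun h Y Z P hY hZ hP p => (SlantMaps.normalConnection_identity_iff hJ hG hY hZ hP p).1
      (h Y Z P hY hZ hP p),
    fun h Y Z P hY hZ hP p => (SlantMaps.normalConnection_identity_iff hJ hG hY hZ hP p).2
      (h Y Z P hY hZ hP p)⟩
  exact ⟨fun _ => hiff.1, fun _ => hiff.2, fun _ _ => hG.1.rangeIntegrable⟩
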